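/- **Setting.** Fix finitely many quantum and classical registers with given sizes; an address is a pair (register, index). A *quantum memory* is a partial map from quantum addresses to Boolean expressions, a *classical memory* is a stack of partial maps from classical addresses to Boolean expressions (the top row is the present, the rest is the past); undefined cells are holes (not allocated). **Hybrid path-sums.** An HPS $h=\langle P,o,s\rangle_{su}$ consists of an input signature (a memory holding input variables $x_i$ or constants), a finite set $su$ of Boolean path variables $y_j$, a phase polynomial $P$ over the dyadic numbers, an output memory $o=(o_{qu},o_{cl})$ of Boolean polynomials, and a scalar $s$ given by the grammar of constructible real numbers (rationals, $\sqrt{\cdot}$, $\cos,\sin$ of angles, $+,-,\cdot,1/\cdot$, variables), all in the variables $x_i$ of the input signature and $y_j\in su$. Fix values of the $x_i$. For a path $y\in 2^{su}$, the value $o_{cl}(y)$ is its history, and $\lceil\eta\rceil$ denotes the top row of a history $\eta$. Put $$\xi(h)(\eta)=\sum_{y:\,o_{cl}(y)=\eta}s(y)e^{2\pi iP(y)}|o_{qu}(y)\rangle,\qquad |h|=\Big(\sum_\eta|\xi(h)(\eta)|^2\Big)^{1/2},$$ $$DO(h)(c)=\sum_{\substack{o_{cl}(y)=o_{cl}(y')\\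 \lceil o_{cl}(y)\rceil=c}}s(y)s(y')e^{2\pi i(P(y)-P(y'))}|o_{qu}(y)\rangle\langle o_{qu}(y')|.$$ **Programs.** Registers are $r$, $R[i{:}]$, $R[{:}i]$, $R[i{:}j]$, $R[i]$; integers are variables, naturals, $+$, $\cdot$, powers and register sizes; classical Booleans are $0,1$, classical registers (the conjunction of their bits), $\oplus,\wedge$ and $b_1?b_2{:}b_3$; Booleans are the same with quantum registers also allowed. Unitary programs are $\mathbf{Skip}$, $p;q$, $\mathbf{For}\ x=i,j\ \mathbf{do}\ p$, $\mathbf{If}\ b\ \mathbf{then}\ p\ \mathbf{else}\ q$ with a Boolean $b$, and $\mathbf{Apply}\ G(Q)$ with $G\in\{H,X\}\cup\{Z_k\}_{k\in\mathbb N}$, $Z_k=\mathrm{diag}(1,e^{2\pi i/2^k})$. Programs are unitary programs, $\mathbf{Init}\ Q$, $p;q$, $\mathbf{For}$, $\mathbf{If}$ with a classical Boolean, $\mathbf{Measure}(Q,C)$ and $C_1:=f(C_2)$ with an arbitrary function $f$ on bit vectors. A program is closed if all its integer variables are bound by $\mathbf{For}$ loops. It is well formed over $h$ if, when it starts with the cells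 allocated in the output of $h$, it initializes only unallocated qubits, reads and acts on allocated cells only, measures between registers of equal size, has disjoint control and target qubits in every quantum $\mathbf{If}$, and both branches of every $\mathbf{If}$ allocate the same cells. **Symbolic semantics** $\llbracket\cdot\rrbracket$ on HPS. $\mathbf{Skip}$ is the identity and $\llbracket p;q\rrbracket=\llbracket q\rrbracket\circ\llbracket p\rrbracket$; $\mathbf{For}\ x=i,j$ runs the body for $x=i,i+1,\dots,j$ in this order; $\mathbf{Init}\ Q$ sets the cells of $Q$ to $0$; $\mathbf{Measure}(Q,C)$ and $C_1:=f(C_2)$ put a new row on the classical stack, in which $C$ (resp. $C_1$) holds the current expressions of $Q$ (resp. of $f(C_2)$) and the other cells are unchanged. On a qubit $q$ holding the expression $\lceil q\rceil$: $H$ multiplies $s$ by $1/\sqrt2$, adds a fresh path variable $y$, adds $y\lceil q\rceil/2$ to $P$ and sets $q$ to $y$; $X$ sets $q$ to $1\oplus\lceil q\rceil$; $Z_k$ adds $\lceil q\rceil/2^k$ to $P$; a gate on a register acts on each of its qubits. Finally $$\llbracket\mathbf{If}\ b\ \mathbf{then}\ p\ \mathbf{else}\ q\rrbracket(h)=\llbracket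 p\rrbracket(b\,h)\boxplus\llbracket q\rrbracket((1-b)\,h),$$ where $b$ is evaluated in $h$, a Boolean factor multiplies $s$, and, with a fresh path variable $y$, $\langle P_1,o_1,s_1\rangle_{su_1}\boxplus\langle P_2,o_2,s_2\rangle_{su_2}$ has support $su_1\cup su_2\cup\{y\}$, phase $y?P_1{:}P_2$, output $y?o_1{:}o_2$ and scalar $y?\big(\prod_{z\in su_2\setminus su_1}z\big)s_1:\big(\prod_{z\in su_1\setminus su_2}z\big)s_2$ (the shorter classical stack is first extended by repeating its top row, and a hole that meets an expression in a past row counts as $0$). **Target language.** $S$ is the language qhl-cv over Boolean classical variables (the classical addresses) and qubits (the quantum addresses): $$S::=\mathbf{skip}\mid\mathbf{abort}\mid x:=e\mid x:=_\$g\mid x:=\mathbf{meas}\ M[\bar q]\mid q:=|0\rangle\mid\bar q*=U\mid S;S\mid\mathbf{if}\ b\ \mathbf{then}\ S\ \mathbf{else}\ S\ \mathbf{end}\mid\mathbf{while}\ b\ \mathbf{do}\ S\ \mathbf{end},$$ with tuples of variables allowed in assignments and measurements, and with its usual denotational semantics $\llbracket\cdot\rrbracket_{cq}$ on cq-states. A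 cq-state over a set $V$ of qubits is a map $\Delta$ of countable support from (partial) classical states to positive semidefinite operators on $\mathcal H_V$ with $\sum_\sigma\mathrm{tr}\,\Delta(\sigma)\le1$; here $q:=|0\rangle$ resets $q$ if $q\in V$, and adds $q$ in state $|0\rangle$ if $q\notin V$. **Theorem (Soundness of the semantics).** There is a non-surjective map $\varphi$ from closed programs to $S$ such that, for every closed program $Pr$, every HPS $h$ over which $Pr$ is well formed, and all values of the input variables for which $|h|\le1$: $DO(h)$ and $DO(\llbracket Pr\rrbracket(h))$ are cq-states (over the qubits allocated in $h$ and in $\llbracket Pr\rrbracket(h)$, respectively), and $$DO(\llbracket Pr\rrbracket(h))=\llbracket\varphi(Pr)\rrbracket_{cq}(DO(h)).$$ -/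

import Mathlib

namespace HQ

/-! ## Memory cells -/

/-- The declared quantum and classical registers: finitely many identifiers of each kind, each with
a size. -/
structure Sig where
  numQ : ℕ
  numC : ℕ
  qsize : Fin numQ → ℕ
  csize : Fin numC → ℕ

/-- Quantum addresses: pairs (register, index). -/
abbrev QCell (sg : Sig) := Σ r : Fin sg.numQ, Fin (sg.qsize r)

/-- Classical addresses: pairs (register, index). -/
abbrev CCell (sg : Sig) := Σ r : Fin sg.numC, Fin (sg.csize r)

/-- A concrete quantum memory (computational basis state): a partial map from quantum addresses to
bits, where `none` is a hole, i.e. an address that is not allocated. -/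
abbrev QState (sg : Sig) := QCell sg → Option Bool

/-- A concrete (present) classical memory, with `none` for holes. -/
abbrev CState (sg : Sig) := CCell sg → Option Bool

/-- An allocation profile: the sets of allocated quantum and classical addresses. -/
structure Alloc (sg : Sig) where
  q : Finset (QCell sg)
  c : Finset (CCell sg)

/-- The set of allocated addresses of a quantum memory. -/
def QState.dom {sg : Sig} (m : QState sg) : Finset (QCell sg) :=
  Finset.univ.filter fun q => (m q).isSome = true

/-! ## Symbolic expressions -/

/-- Symbolic Boolean variables: `Sum.inl i` is the input variable `x_i`, `Sum.inr j` is the path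
variable `y_j`. -/
abbrev SVar := ℕ ⊕ ℕ

/-- Boolean polynomials in the symbolic variables. -/
inductive BExp where
  | zero : BExp
  | one : BExp
  | var : SVar → BExp
  | and : BExp → BExp → BExp
  | xor : BExp → BExp → BExp

namespace BExp

/-- Value under a valuation of the symbolic variables. -/
def eval (v : SVar → Bool) : BExp → Bool
  | zero => false
  | one => true
  | var a => v a
  | and a b => a.eval v && b.eval v
  | xor a b => Bool.xor (a.eval v) (b.eval v)

/-- The variables that occur. -/
def vars : BExp → Finset SVar
  | zero => ∅
  | one => ∅
  | var a => {a}
  | and a b => a.vars ∪ b.vars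
  | xor a b => a.vars ∪ b.vars

/-- The ternary `a ? b : c` (if `a` then `b` else `c`). -/
def cond (a b c : BExp) : BExp := xor (and a b) (and (xor a one) c)

/-- Conjunction of a list. -/
def conj (l : List BExp) : BExp := l.foldr and one

/-- The Boolean polynomial `f (b₁, …, bₙ)`, for a Boolean function `f`. -/
def ofFun : List BExp → (List Bool → Bool) → BExp
  | [], f => if f [] then one else zero
  | b :: bs, f => cond b (ofFun bs fun l => f (true :: l)) (ofFun bs fun l => f (false :: l))

end BExp

/-- Phase polynomials over the dyadics: `0`, `b / 2^k`, `i / 2^k`, sums, products by integers and by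
Booleans, opposites. -/
inductive Phase where
  | zero : Phase
  | bool : BExp → ℕ → Phase
  | int : ℤ → ℕ → Phase
  | add : Phase → Phase → Phase
  | smul : ℤ → Phase → Phase
  | bmul : BExp → Phase → Phase
  | neg : Phase → Phase

namespace Phase

noncomputable def eval (v : SVar → Bool) : Phase → ℝ
  | zero => 0
  | bool b k => (if b.eval v then 1 else 0) / 2 ^ k
  | int i k => (i : ℝ) / 2 ^ k
  | add p q => p.eval v + q.eval v
  | smul i p => (i : ℝ) * p.eval v
  | bmul b p => (if b.eval v then 1 else 0) * p.eval v
  | neg p => - p.eval v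

def vars : Phase → Finset SVar
  | zero => ∅
  | bool b _ => b.vars
  | int _ _ => ∅
  | add p q => p.vars ∪ q.vars
  | smul _ p => p.vars
  | bmul b p => b.vars ∪ p.vars
  | neg p => p.vars

/-- `b ? p : q`. -/
def cond (b : BExp) (p q : Phase) : Phase := add (bmul b p) (bmul (BExp.xor b BExp.one) q)

end Phase

mutual
/-- Scalars: expressions for constructible real numbers. -/
inductive Scalar where
  | rat : ℤ → ℤ → Scalar
  | sqrt : Scalar → Scalar
  | cos : Angle → Scalar
  | sin : Angle → Scalar
  | add : Scalar → Scalar → Scalar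
  | neg : Scalar → Scalar
  | mul : Scalar → Scalar → Scalar
  | inv : Scalar → Scalar
  | var : SVar → Scalar
/-- Angles; `dyadic i k` is `2 π i / 2^k`. -/
inductive Angle where
  | dyadic : ℤ → ℕ → Angle
  | arccos : Scalar → Angle
  | arcsin : Scalar → Angle
  | smul : ℤ → Angle → Angle
  | bmul : BExp → Angle → Angle
  | add : Angle → Angle → Angle
  | neg : Angle → Angle
end

mutual
noncomputable def Scalar.eval (v : SVar → Bool) : Scalar → ℝ
  | .rat i j => (i : ℝ) / (j : ℝ)
  | .sqrt s => Real.sqrt (s.eval v)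
  | .cos a => Real.cos (a.eval v)
  | .sin a => Real.sin (a.eval v)
  | .add s t => s.eval v + t.eval v
  | .neg s => - s.eval v
  | .mul s t => s.eval v * t.eval v
  | .inv s => (s.eval v)⁻¹
  | .var a => if v a then 1 else 0
noncomputable def Angle.eval (v : SVar → Bool) : Angle → ℝ
  | .dyadic i k => 2 * Real.pi * (i : ℝ) / 2 ^ k
  | .arccos s => Real.arccos (s.eval v)
  | .arcsin s => Real.arcsin (s.eval v)
  | .smul i a => (i : ℝ) * a.eval v
  | .bmul b a => (if b.eval v then 1 else 0) * a.eval v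
  | .add a b => a.eval v + b.eval v
  | .neg a => - a.eval v
end

mutual
def Scalar.vars : Scalar → Finset SVar
  | .rat _ _ => ∅
  | .sqrt s => s.vars
  | .cos a => a.vars
  | .sin a => a.vars
  | .add s t => s.vars ∪ t.vars
  | .neg s => s.vars
  | .mul s t => s.vars ∪ t.vars
  | .inv s => s.vars
  | .var a => {a}
def Angle.vars : Angle → Finset SVar
  | .dyadic _ _ => ∅
  | .arccos s => s.vars
  | .arcsin s => s.vars
  | .smul _ a => a.vars
  | .bmul b a => b.vars ∪ a.vars
  | .add a b => a.vars ∪ b.vars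
  | .neg a => a.vars
end

namespace Scalar

/-- A Boolean polynomial as a scalar with value 0 or 1. -/
def lift : BExp → Scalar
  | .zero => rat 0 1
  | .one => rat 1 1
  | .var a => var a
  | .and a b => mul (lift a) (lift b)
  | .xor a b => add (add (lift a) (lift b)) (neg (mul (rat 2 1) (mul (lift a) (lift b))))

/-- `b ? s : t`. -/
def cond (b : BExp) (s t : Scalar) : Scalar :=
  add (mul (lift b) s) (mul (lift (BExp.xor b BExp.one)) t)

/-- `(∏_{j ∈ J} y_j) * s`. -/
noncomputable def filterBy (J : Finset ℕ) (s : Scalar) : Scalar :=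
  J.toList.foldr (fun j r => mul (var (Sum.inr j)) r) s

end Scalar

/-! ## Hybrid memories and hybrid path-sums -/

/-- A row of a symbolic classical memory. -/
abbrev CRow (sg : Sig) := CCell sg → Option BExp

/-- Symbolic hybrid memories: a partial map from quantum addresses to Boolean expressions, and a
stack of partial maps from classical addresses to Boolean expressions; the head of the stack is the
present classical memory and the tail its past. -/
structure HMem (sg : Sig) where
  q : QCell sg → Option BExp
  c : List (CRow sg)

namespace HMem
variable {sg : Sig}

/-- The present classical memory; the empty map if the stack is empty. -/
def top (c : List (CRow sg)) : CRow sg := c.headD fun _ => none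

/-- The expression `e` occurs in the memory. -/
def Holds (m : HMem sg) (e : BExp) : Prop :=
  (∃ a, m.q a = some e) ∨ ∃ r ∈ m.c, ∃ a, r a = some e

end HMem

/-- Hybrid path-sums: input signature, path support, phase, output signature, scalar. -/
structure HPS (sg : Sig) where
  input : HMem sg
  su : Finset ℕ
  p : Phase
  o : HMem sg
  s : Scalar

/-- Concrete histories: stacks of concrete classical memories, the head being the present. -/
abbrev History (sg : Sig) := List (CState sg)

/-- The present classical memory of a history. -/
def History.present {sg : Sig} (η : History sg) : CState sg := η.headD fun _ => none

/-- The valuation given by the values `x` of the input variables and the path `t`, a path being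
given by the set of the path variables that have value 1. -/
def val (x : ℕ → Bool) (t : Finset ℕ) : SVar → Bool := Sum.elim x fun j => decide (j ∈ t)

namespace HPS
variable {sg : Sig}

/-- The variables in scope: the path variables of the support and the variables of the input
signature. -/
def scope (h : HPS sg) : Set SVar :=
  {v | (∃ j ∈ h.su, v = Sum.inr j) ∨ ∃ e, h.input.Holds e ∧ v ∈ e.vars}

/-- The conditions in the definition of an HPS: the input signature holds input variables or
constants, and the phase, the output and the scalar are expressions in the variables in scope. -/
structure WellScoped (h : HPS sg) : Prop where
  input_atomic : ∀ e, h.input.Holds e → e = BExp.zero ∨ e = BExp.one ∨ ∃ i, e = BExp.var (Sum.inl i)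
  phase_scoped : ∀ v ∈ h.p.vars, v ∈ h.scope
  scalar_scoped : ∀ v ∈ h.s.vars, v ∈ h.scope
  output_scoped : ∀ e, h.o.Holds e → ∀ v ∈ e.vars, v ∈ h.scope

/-- The allocated quantum addresses and the allocated present classical addresses. -/
def alloc (h : HPS sg) : Alloc sg where
  q := Finset.univ.filter fun a => (h.o.q a).isSome = true
  c := Finset.univ.filter fun a => (HMem.top h.o.c a).isSome = true

/-- The basis state of the quantum memory along a path. -/
def qval (h : HPS sg) (v : SVar → Bool) : QState sg := fun a => (h.o.q a).map (BExp.eval v)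

/-- The history along a path. -/
def history (h : HPS sg) (v : SVar → Bool) : History sg :=
  h.o.c.map fun r a => (r a).map (BExp.eval v)

/-- Vector map: `ξ(h)(η)` is the sum of `s(y) e^{2πi P(y)} |o_qu(y)⟩` over the paths `y` of history
`η`. -/
noncomputable def xi (h : HPS sg) (x : ℕ → Bool) (η : History sg) : EuclideanSpace ℂ (QState sg) :=
  ∑ t ∈ h.su.powerset,
    if h.history (val x t) = η then
      EuclideanSpace.single (h.qval (val x t))
        ((h.s.eval (val x t) : ℂ) *
          Complex.exp (2 * Real.pi * Complex.I * (h.p.eval (val x t) : ℂ)))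
    else 0

/-- `|h|`, the square root of the sum of the `|ξ(h)(η)|²`; only the finitely many histories that are
reached along some path contribute. -/
noncomputable def norm (h : HPS sg) (x : ℕ → Bool) : ℝ :=
  Real.sqrt (∑ η ∈ h.su.powerset.image (fun t => h.history (val x t)), ‖h.xi x η‖ ^ 2)

end HPS

/-! ## cq-states -/

/-- Maps from classical states to operators. The operators act on the space spanned by all partial
quantum memories, which is the direct sum, over the sets `V` of qubits, of the spaces `H_V`. -/
abbrev CQMap (sg : Sig) := CState sg → Matrix (QState sg) (QState sg) ℂ

open scoped ComplexOrder in
/-- cq-states over the set `V` of qubits: maps of countable support into the partial density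
operators on `H_V`, of total trace at most 1. -/
structure IsCQState {sg : Sig} (V : Finset (QCell sg)) (Δ : CQMap sg) : Prop where
  on_V : ∀ c m m', Δ c m m' ≠ 0 → QState.dom m = V ∧ QState.dom m' = V
  posSemidef : ∀ c, (Δ c).PosSemidef
  countable_support : (Function.support Δ).Countable
  trace_le : (∑ c, (Δ c).trace).re ≤ 1

/-- Density operator map: `DO(h)(c)` is the sum, over the pairs of paths with the same history and
with present classical memory `c`, of
`s(y₁) s(y₂) e^{2πi (P(y₁) - P(y₂))} |o_qu(y₁)⟩⟨o_qu(y₂)|`. -/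
noncomputable def HPS.densityOp {sg : Sig} (h : HPS sg) (x : ℕ → Bool) : CQMap sg := fun c =>
  ∑ t₁ ∈ h.su.powerset, ∑ t₂ ∈ h.su.powerset,
    if h.history (val x t₁) = h.history (val x t₂) ∧ (h.history (val x t₁)).present = c then
      Matrix.single (h.qval (val x t₁)) (h.qval (val x t₂))
        ((h.s.eval (val x t₁) : ℂ) * (h.s.eval (val x t₂) : ℂ) *
          Complex.exp (2 * Real.pi * Complex.I *
            ((h.p.eval (val x t₁) : ℂ) - (h.p.eval (val x t₂) : ℂ))))
    else 0

/-! ## Syntax of HQbricks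

Closed terms are in normal form; the only variables left in them are the integer variables bound by
the `For` loops. -/

mutual
/-- Integer expressions. -/
inductive IExp (sg : Sig) where
  | var : ℕ → IExp sg
  | const : ℕ → IExp sg
  | add : IExp sg → IExp sg → IExp sg
  | mul : IExp sg → IExp sg → IExp sg
  | pow : IExp sg → IExp sg → IExp sg
  | cardC : CReg sg → IExp sg
  | cardQ : QReg sg → IExp sg
/-- Quantum registers: identifiers and `Q[i:]`, `Q[:i]`, `Q[i:j]`, `Q[i]`. -/
inductive QReg (sg : Sig) where
  | ident : Fin sg.numQ → QReg sg
  | drop : QReg sg → IExp sg → QReg sg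
  | take : QReg sg → IExp sg → QReg sg
  | slice : QReg sg → IExp sg → IExp sg → QReg sg
  | get : QReg sg → IExp sg → QReg sg
/-- Classical registers: identifiers and `C[i:]`, `C[:i]`, `C[i:j]`, `C[i]`. -/
inductive CReg (sg : Sig) where
  | ident : Fin sg.numC → CReg sg
  | drop : CReg sg → IExp sg → CReg sg
  | take : CReg sg → IExp sg → CReg sg
  | slice : CReg sg → IExp sg → IExp sg → CReg sg
  | get : CReg sg → IExp sg → CReg sg
end

/-- Values of the integer variables. -/
abbrev Env := ℕ → ℕ

mutual
/-- Value of an integer expression. -/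
def IExp.eval {sg : Sig} (ρ : Env) : IExp sg → ℕ
  | .var n => ρ n
  | .const n => n
  | .add i j => i.eval ρ + j.eval ρ
  | .mul i j => i.eval ρ * j.eval ρ
  | .pow i j => i.eval ρ ^ j.eval ρ
  | .cardC C => (C.cells ρ).length
  | .cardQ Q => (Q.cells ρ).length
/-- The array of the addresses of a quantum register. -/
def QReg.cells {sg : Sig} (ρ : Env) : QReg sg → List (QCell sg)
  | .ident r => (List.finRange (sg.qsize r)).map fun k => ⟨r, k⟩
  | .drop Q i => (Q.cells ρ).drop (i.eval ρ)
  | .take Q i => (Q.cells ρ).take (i.eval ρ)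
  | .slice Q i j => ((Q.cells ρ).take (j.eval ρ)).drop (i.eval ρ)
  | .get Q i => ((Q.cells ρ).drop (i.eval ρ)).take 1
/-- The array of the addresses of a classical register. -/
def CReg.cells {sg : Sig} (ρ : Env) : CReg sg → List (CCell sg)
  | .ident r => (List.finRange (sg.csize r)).map fun k => ⟨r, k⟩
  | .drop C i => (C.cells ρ).drop (i.eval ρ)
  | .take C i => (C.cells ρ).take (i.eval ρ)
  | .slice C i j => ((C.cells ρ).take (j.eval ρ)).drop (i.eval ρ)
  | .get C i => ((C.cells ρ).drop (i.eval ρ)).take 1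
end

/-- Classical Booleans; a register stands for the conjunction of its bits. -/
inductive CBool (sg : Sig) where
  | zero : CBool sg
  | one : CBool sg
  | reg : CReg sg → CBool sg
  | xor : CBool sg → CBool sg → CBool sg
  | and : CBool sg → CBool sg → CBool sg
  | cond : CBool sg → CBool sg → CBool sg → CBool sg

/-- Booleans under which unitary programs can be controlled. Classical Booleans are a subtype, so
that hybrid control is included. -/
inductive QBool (sg : Sig) where
  | zero : QBool sg
  | one : QBool sg
  | reg : QReg sg → QBool sg
  | ofC : CBool sg → QBool sg
  | xor : QBool sg → QBool sg → QBool sg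
  | and : QBool sg → QBool sg → QBool sg
  | cond : QBool sg → QBool sg → QBool sg → QBool sg

/-- The gates: Hadamard, not, and the rotations `Z_k = diag(1, e^{2πi/2^k})`. -/
inductive Gate where
  | H : Gate
  | X : Gate
  | Z : ℕ → Gate

/-- Unitary programs. `loop x i j p` is `For x = i, j do p`. -/
inductive QProg (sg : Sig) where
  | skip : QProg sg
  | seq : QProg sg → QProg sg → QProg sg
  | loop : ℕ → IExp sg → IExp sg → QProg sg → QProg sg
  | ite : QBool sg → QProg sg → QProg sg → QProg sg
  | apply : Gate → QReg sg → QProg sg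

/-- Programs. In `oracle C₁ f C₂`, i.e. `C₁ := f(C₂)`, the bit `k` of `f(b)` is `f b k`. -/
inductive Prog (sg : Sig) where
  | init : QReg sg → Prog sg
  | quantum : QProg sg → Prog sg
  | seq : Prog sg → Prog sg → Prog sg
  | loop : ℕ → IExp sg → IExp sg → Prog sg → Prog sg
  | ite : CBool sg → Prog sg → Prog sg → Prog sg
  | measure : QReg sg → CReg sg → Prog sg
  | oracle : CReg sg → (List Bool → ℕ → Bool) → CReg sg → Prog sg

/-! ### Closed programs

`Closed B t` says that all the free variables of `t` are in `B`. -/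

mutual
def IExp.Closed {sg : Sig} (B : Finset ℕ) : IExp sg → Prop
  | .var n => n ∈ B
  | .const _ => True
  | .add i j => i.Closed B ∧ j.Closed B
  | .mul i j => i.Closed B ∧ j.Closed B
  | .pow i j => i.Closed B ∧ j.Closed B
  | .cardC C => C.Closed B
  | .cardQ Q => Q.Closed B
def QReg.Closed {sg : Sig} (B : Finset ℕ) : QReg sg → Prop
  | .ident _ => True
  | .drop Q i => Q.Closed B ∧ i.Closed B
  | .take Q i => Q.Closed B ∧ i.Closed B
  | .slice Q i j => Q.Closed B ∧ i.Closed B ∧ j.Closed B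
  | .get Q i => Q.Closed B ∧ i.Closed B
def CReg.Closed {sg : Sig} (B : Finset ℕ) : CReg sg → Prop
  | .ident _ => True
  | .drop C i => C.Closed B ∧ i.Closed B
  | .take C i => C.Closed B ∧ i.Closed B
  | .slice C i j => C.Closed B ∧ i.Closed B ∧ j.Closed B
  | .get C i => C.Closed B ∧ i.Closed B
end

def CBool.Closed {sg : Sig} (B : Finset ℕ) : CBool sg → Prop
  | .zero => True
  | .one => True
  | .reg C => C.Closed B
  | .xor a b => a.Closed B ∧ b.Closed B
  | .and a b => a.Closed B ∧ b.Closed B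
  | .cond a b c => a.Closed B ∧ b.Closed B ∧ c.Closed B

def QBool.Closed {sg : Sig} (B : Finset ℕ) : QBool sg → Prop
  | .zero => True
  | .one => True
  | .reg Q => Q.Closed B
  | .ofC b => b.Closed B
  | .xor a b => a.Closed B ∧ b.Closed B
  | .and a b => a.Closed B ∧ b.Closed B
  | .cond a b c => a.Closed B ∧ b.Closed B ∧ c.Closed B

def QProg.Closed {sg : Sig} : Finset ℕ → QProg sg → Prop
  | _, .skip => True
  | B, .seq p q => p.Closed B ∧ q.Closed B
  | B, .loop x i j p => i.Closed B ∧ j.Closed B ∧ p.Closed (insert x B)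
  | B, .ite b p q => b.Closed B ∧ p.Closed B ∧ q.Closed B
  | B, .apply _ Q => Q.Closed B

def Prog.Closed {sg : Sig} : Finset ℕ → Prog sg → Prop
  | B, .init Q => Q.Closed B
  | B, .quantum p => p.Closed B
  | B, .seq p q => p.Closed B ∧ q.Closed B
  | B, .loop x i j p => i.Closed B ∧ j.Closed B ∧ p.Closed (insert x B)
  | B, .ite b p q => b.Closed B ∧ p.Closed B ∧ q.Closed B
  | B, .measure Q C => Q.Closed B ∧ C.Closed B
  | B, .oracle C₁ _ C₂ => C₁.Closed B ∧ C₂.Closed B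

/-- Closed programs: no free variable. -/
abbrev ClosedProg (sg : Sig) := {p : Prog sg // p.Closed ∅}

/-! ### Well-formedness -/

/-- The values `i, i + 1, …, j` of a loop variable; none if `j < i`. -/
def loopRange (i j : ℕ) : List ℕ := List.range' i (j + 1 - i)

/-- The classical addresses read by a classical Boolean. -/
def CBool.cells {sg : Sig} (ρ : Env) : CBool sg → Finset (CCell sg)
  | .zero => ∅
  | .one => ∅
  | .reg C => (C.cells ρ).toFinset
  | .xor a b => a.cells ρ ∪ b.cells ρ
  | .and a b => a.cells ρ ∪ b.cells ρ
  | .cond a b c => a.cells ρ ∪ b.cells ρ ∪ c.cells ρ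

/-- The classical addresses read by a Boolean. -/
def QBool.ccells {sg : Sig} (ρ : Env) : QBool sg → Finset (CCell sg)
  | .zero => ∅
  | .one => ∅
  | .reg _ => ∅
  | .ofC b => b.cells ρ
  | .xor a b => a.ccells ρ ∪ b.ccells ρ
  | .and a b => a.ccells ρ ∪ b.ccells ρ
  | .cond a b c => a.ccells ρ ∪ b.ccells ρ ∪ c.ccells ρ

/-- The control qubits: the quantum addresses read by a Boolean. -/
def QBool.qcells {sg : Sig} (ρ : Env) : QBool sg → Finset (QCell sg)
  | .zero => ∅
  | .one => ∅
  | .reg Q => (Q.cells ρ).toFinset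
  | .ofC _ => ∅
  | .xor a b => a.qcells ρ ∪ b.qcells ρ
  | .and a b => a.qcells ρ ∪ b.qcells ρ
  | .cond a b c => a.qcells ρ ∪ b.qcells ρ ∪ c.qcells ρ

/-- The target qubits of a unitary program: those to which it applies a gate. -/
def QProg.targets {sg : Sig} : Env → QProg sg → Finset (QCell sg)
  | _, .skip => ∅
  | ρ, .seq p q => p.targets ρ ∪ q.targets ρ
  | ρ, .loop x i j p =>
      (loopRange (i.eval ρ) (j.eval ρ)).toFinset.biUnion fun k =>
        p.targets (Function.update ρ x k)
  | ρ, .ite _ p q => p.targets ρ ∪ q.targets ρ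
  | ρ, .apply _ Q => (Q.cells ρ).toFinset

/-- Well-formedness of a unitary program over an allocation profile: gates and controls use
allocated addresses only, and no qubit is at once a control and a target of it. -/
def QProg.WellFormed {sg : Sig} (A : Alloc sg) : Env → QProg sg → Prop
  | _, .skip => True
  | ρ, .seq p q => p.WellFormed A ρ ∧ q.WellFormed A ρ
  | ρ, .loop x i j p =>
      ∀ k ∈ loopRange (i.eval ρ) (j.eval ρ), p.WellFormed A (Function.update ρ x k)
  | ρ, .ite b p q =>
      b.qcells ρ ⊆ A.q ∧ b.ccells ρ ⊆ A.c ∧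
      Disjoint (b.qcells ρ) (p.targets ρ) ∧ Disjoint (b.qcells ρ) (q.targets ρ) ∧
      p.WellFormed A ρ ∧ q.WellFormed A ρ
  | ρ, .apply _ Q => (Q.cells ρ).toFinset ⊆ A.q

open Classical in
/-- The allocation profile after a program, from a given profile; `none` if the program is not well
formed there. Qubits are initialized only when they are not allocated, only allocated addresses are
read or acted on, measurement is between registers of the same size, and the two branches of a
conditional lead to the same profile. -/
noncomputable def Prog.profile {sg : Sig} : Env → Prog sg → Alloc sg → Option (Alloc sg)
  | ρ, .init Q, A =>
      if Disjoint (Q.cells ρ).toFinset A.q then some ⟨A.q ∪ (Q.cells ρ).toFinset, A.c⟩ else none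
  | ρ, .quantum p, A => if p.WellFormed A ρ then some A else none
  | ρ, .seq p q, A => (p.profile ρ A).bind fun A' => q.profile ρ A'
  | ρ, .loop x i j p, A =>
      (loopRange (i.eval ρ) (j.eval ρ)).foldl
        (fun r k => r.bind fun A' => p.profile (Function.update ρ x k) A') (some A)
  | ρ, .ite b p q, A =>
      if b.cells ρ ⊆ A.c ∧ p.profile ρ A = q.profile ρ A then p.profile ρ A else none
  | ρ, .measure Q C, A =>
      if (Q.cells ρ).toFinset ⊆ A.q ∧ (Q.cells ρ).length = (C.cells ρ).length then
        some ⟨A.q, A.c ∪ (C.cells ρ).toFinset⟩ else none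
  | ρ, .oracle C₁ _ C₂, A =>
      if (C₂.cells ρ).toFinset ⊆ A.c then some ⟨A.q, A.c ∪ (C₁.cells ρ).toFinset⟩ else none

/-- The empty environment; its values play no role for closed programs. -/
def Env.empty : Env := fun _ => 0

/-- The closed program is well formed on memories of the allocation profile `A`. -/
def ClosedProg.WellFormed {sg : Sig} (P : ClosedProg sg) (A : Alloc sg) : Prop :=
  (P.1.profile Env.empty A).isSome = true

/-! ## Forward symbolic semantics -/

namespace HPS
variable {sg : Sig}

/-- `⌈q⌉`, the expression held at a quantum address. -/
def curQ (h : HPS sg) (a : QCell sg) : BExp := (h.o.q a).getD BExp.zero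

/-- `⌈c⌉`, the expression held at present at a classical address. -/
def curC (h : HPS sg) (a : CCell sg) : BExp := (HMem.top h.o.c a).getD BExp.zero

/-- `h[q ← b]`. -/
def setQ (h : HPS sg) (a : QCell sg) (b : BExp) : HPS sg :=
  { h with o := { h.o with q := Function.update h.o.q a (some b) } }

/-- `h[C ← b]` for a register: a new present row, with the new values at the addresses of `C` and the
old ones elsewhere, is put on top of the history stack. -/
def push (h : HPS sg) (C : List (CCell sg)) (b : List BExp) : HPS sg :=
  { h with o := { h.o with
      c := (fun a => ((C.zip b).lookup a).or (HMem.top h.o.c a)) :: h.o.c } }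

/-- `h +_p P`. -/
def addPhase (h : HPS sg) (P : Phase) : HPS sg := { h with p := Phase.add h.p P }

/-- `r · h` for a scalar `r`. -/
def scale (r : Scalar) (h : HPS sg) : HPS sg := { h with s := Scalar.mul r h.s }

/-- `h ∪_su {y}`. -/
def addPath (h : HPS sg) (y : ℕ) : HPS sg := { h with su := insert y h.su }

/-- A path variable that is not in the support. -/
def fresh (su : Finset ℕ) : ℕ := su.sup id + 1

/-- Extension of a stack to length `n` by repetition of the present row. -/
def padTo (n : ℕ) (c : List (CRow sg)) : List (CRow sg) :=
  List.replicate (n - c.length) (HMem.top c) ++ c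

/-- `y ? a : b` for memory cells. In well-formed programs a hole can meet an expression only in past
rows; it then counts as the constant 0. -/
def mergeCell (y : BExp) : Option BExp → Option BExp → Option BExp
  | none, none => none
  | a, b => some (BExp.cond y (a.getD BExp.zero) (b.getD BExp.zero))

/-- `y ? m₁ : m₂` for memories. Stacks of different lengths are first brought to the same length. -/
def mergeMem (y : BExp) (m₁ m₂ : HMem sg) : HMem sg where
  q := fun a => mergeCell y (m₁.q a) (m₂.q a)
  c := List.zipWith (fun r₁ r₂ a => mergeCell y (r₁ a) (r₂ a))
    (padTo (max m₁.c.length m₂.c.length) m₁.c) (padTo (max m₁.c.length m₂.c.length) m₂.c)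

/-- The sum of two HPS (with the same input signature), by case analysis on a fresh path variable. -/
noncomputable def plus (h₁ h₂ : HPS sg) : HPS sg :=
  let y := fresh (h₁.su ∪ h₂.su)
  let b := BExp.var (Sum.inr y)
  { input := h₁.input
    su := insert y (h₁.su ∪ h₂.su)
    p := Phase.cond b h₁.p h₂.p
    o := mergeMem b h₁.o h₂.o
    s := Scalar.cond b (Scalar.filterBy (h₂.su \ h₁.su) h₁.s)
      (Scalar.filterBy (h₁.su \ h₂.su) h₂.s) }

/-- A gate on one qubit. -/
def gate (G : Gate) (a : QCell sg) (h : HPS sg) : HPS sg :=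
  match G with
  | .H =>
      let y := fresh h.su
      (((h.scale (Scalar.inv (Scalar.sqrt (Scalar.rat 2 1)))).addPath y).addPhase
        (Phase.bool (BExp.and (BExp.var (Sum.inr y)) (h.curQ a)) 1)).setQ a
          (BExp.var (Sum.inr y))
  | .X => h.setQ a (BExp.xor BExp.one (h.curQ a))
  | .Z k => h.addPhase (Phase.bool (h.curQ a) k)

/-- The part `b · h` of `h` that satisfies `b`. -/
def restrict (b : BExp) (h : HPS sg) : HPS sg := h.scale (Scalar.lift b)

end HPS

/-- The expression of a classical Boolean in an HPS. -/
def CBool.sym {sg : Sig} (ρ : Env) (h : HPS sg) : CBool sg → BExp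
  | .zero => BExp.zero
  | .one => BExp.one
  | .reg C => BExp.conj ((C.cells ρ).map h.curC)
  | .xor a b => BExp.xor (a.sym ρ h) (b.sym ρ h)
  | .and a b => BExp.and (a.sym ρ h) (b.sym ρ h)
  | .cond a b c => BExp.cond (a.sym ρ h) (b.sym ρ h) (c.sym ρ h)

/-- The expression of a Boolean in an HPS. -/
def QBool.sym {sg : Sig} (ρ : Env) (h : HPS sg) : QBool sg → BExp
  | .zero => BExp.zero
  | .one => BExp.one
  | .reg Q => BExp.conj ((Q.cells ρ).map h.curQ)
  | .ofC b => b.sym ρ h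
  | .xor a b => BExp.xor (a.sym ρ h) (b.sym ρ h)
  | .and a b => BExp.and (a.sym ρ h) (b.sym ρ h)
  | .cond a b c => BExp.cond (a.sym ρ h) (b.sym ρ h) (c.sym ρ h)

/-- Symbolic execution of unitary programs. -/
noncomputable def QProg.run {sg : Sig} : Env → QProg sg → HPS sg → HPS sg
  | _, .skip, h => h
  | ρ, .seq p q, h => q.run ρ (p.run ρ h)
  | ρ, .loop x i j p, h =>
      (loopRange (i.eval ρ) (j.eval ρ)).foldl (fun h k => p.run (Function.update ρ x k) h) h
  | ρ, .ite b p q, h =>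
      (p.run ρ (h.restrict (b.sym ρ h))).plus
        (q.run ρ (h.restrict (BExp.xor BExp.one (b.sym ρ h))))
  | ρ, .apply G Q, h => (Q.cells ρ).foldl (fun h a => h.gate G a) h

/-- Symbolic execution of programs. -/
noncomputable def Prog.run {sg : Sig} : Env → Prog sg → HPS sg → HPS sg
  | ρ, .init Q, h => (Q.cells ρ).foldl (fun h a => h.setQ a BExp.zero) h
  | ρ, .quantum p, h => p.run ρ h
  | ρ, .seq p q, h => q.run ρ (p.run ρ h)
  | ρ, .loop x i j p, h =>
      (loopRange (i.eval ρ) (j.eval ρ)).foldl (fun h k => p.run (Function.update ρ x k) h) h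
  | ρ, .ite b p q, h =>
      (p.run ρ (h.restrict (b.sym ρ h))).plus
        (q.run ρ (h.restrict (BExp.xor BExp.one (b.sym ρ h))))
  | ρ, .measure Q C, h => h.push (C.cells ρ) ((Q.cells ρ).map h.curQ)
  | ρ, .oracle C₁ f C₂, h =>
      h.push (C₁.cells ρ) ((List.range (C₁.cells ρ).length).map fun k =>
        BExp.ofFun ((C₂.cells ρ).map h.curC) fun l => f l k)

/-- The interpretation of a closed program as a transformation of HPS. -/
noncomputable def ClosedProg.run {sg : Sig} (P : ClosedProg sg) (h : HPS sg) : HPS sg :=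
  P.1.run Env.empty h

/-! ## The language qhl-cv -/

/-- Statements of the classical-quantum while language, over Boolean classical variables and qubits.
A tuple of distinct variables is given by the set of its members. -/
inductive Stmt (sg : Sig) where
  | skip : Stmt sg
  | abort : Stmt sg
  /-- `x := e`, with `e` a function of the variables `Y`. -/
  | assign (X Y : Finset (CCell sg)) (e : (Y → Bool) → (X → Bool)) : Stmt sg
  /-- `x :=_$ g`, random assignment. -/
  | random (X : Finset (CCell sg)) (g : PMF (X → Bool)) : Stmt sg
  /-- `x := meas M[q]`, for a quantum measurement `M = (M_i)`. -/
  | meas (X : Finset (CCell sg)) (Q : Finset (QCell sg))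
      (M : (X → Bool) → Matrix (Q → Bool) (Q → Bool) ℂ)
      (complete : ∑ i, (M i).conjTranspose * M i = 1) : Stmt sg
  /-- `q := |0⟩`. -/
  | reset (q : QCell sg) : Stmt sg
  /-- `q *= U`. -/
  | unitary (Q : Finset (QCell sg)) (U : Matrix.unitaryGroup (Q → Bool) ℂ) : Stmt sg
  | seq : Stmt sg → Stmt sg → Stmt sg
  /-- `if b then S₁ else S₀ end`, with `b` a function of the variables `Y`. -/
  | ite (Y : Finset (CCell sg)) (b : (Y → Bool) → Bool) (S₁ S₀ : Stmt sg) : Stmt sg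
  /-- `while b do S end`. -/
  | loop (Y : Finset (CCell sg)) (b : (Y → Bool) → Bool) (S : Stmt sg) : Stmt sg

/-- The values of the variables `Y`. -/
def CState.read {sg : Sig} (σ : CState sg) (Y : Finset (CCell sg)) : Y → Bool :=
  fun a => (σ a.1).getD false

/-- `σ[v/X]`. -/
def CState.write {sg : Sig} (σ : CState sg) (X : Finset (CCell sg)) (v : X → Bool) : CState sg :=
  fun a => if ha : a ∈ X then some (v ⟨a, ha⟩) else σ a

/-- The operator `M` on the qubits `Q`, extended by the identity on the other qubits; it is zero on
the memories where some qubit of `Q` is not allocated. -/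
def liftOp {sg : Sig} (Q : Finset (QCell sg)) (M : Matrix (Q → Bool) (Q → Bool) ℂ) :
    Matrix (QState sg) (QState sg) ℂ :=
  fun m m' =>
    if (∀ a, a ∉ Q → m a = m' a) ∧ (∀ a ∈ Q, (m a).isSome = true ∧ (m' a).isSome = true) then
      M (fun a => (m a.1).getD false) (fun a => (m' a.1).getD false)
    else 0

/-- The operator `|0⟩⟨n|` on the cell `a`, extended by the identity, for `n` a bit or the hole. -/
def resetOp {sg : Sig} (a : QCell sg) (n : Option Bool) : Matrix (QState sg) (QState sg) ℂ :=
  fun m m' => if m' a = n ∧ m = Function.update m' a (some false) then 1 else 0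

/-- The part of a map on the classical states where the guard has value `d`. -/
def CQMap.guard {sg : Sig} (Y : Finset (CCell sg)) (b : (Y → Bool) → Bool) (d : Bool)
    (Δ : CQMap sg) : CQMap sg :=
  fun σ => if b (CState.read σ Y) = d then Δ σ else 0

/-- The denotational semantics of statements. The semantics of `q := |0⟩` is
`ρ ↦ ∑_n |0⟩⟨n| ρ |n⟩⟨0|`: it resets an allocated qubit, and it allocates an unallocated one. -/
noncomputable def Stmt.sem {sg : Sig} : Stmt sg → CQMap sg → CQMap sg
  | .skip, Δ => Δ
  | .abort, _ => 0
  | .assign X Y e, Δ => fun σ' =>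
      ∑ σ : CState sg, if CState.write σ X (e (CState.read σ Y)) = σ' then Δ σ else 0
  | .random X g, Δ => fun σ' =>
      ∑ σ : CState sg, ∑ i : X → Bool,
        if CState.write σ X i = σ' then ((g i).toReal : ℂ) • Δ σ else 0
  | .meas X Q M _, Δ => fun σ' =>
      ∑ σ : CState sg, ∑ i : X → Bool,
        if CState.write σ X i = σ' then
          liftOp Q (M i) * Δ σ * (liftOp Q (M i)).conjTranspose
        else 0
  | .reset a, Δ => fun σ =>
      ∑ n : Option Bool, resetOp a n * Δ σ * (resetOp a n).conjTranspose
  | .unitary Q U, Δ => fun σ => liftOp Q U.1 * Δ σ * (liftOp Q U.1).conjTranspose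
  | .seq S T, Δ => T.sem (S.sem Δ)
  | .ite Y b S₁ S₀, Δ => S₁.sem (Δ.guard Y b true) + S₀.sem (Δ.guard Y b false)
  | .loop Y b S, Δ =>
      ∑' n : ℕ, CQMap.guard Y b false ((fun Δ' => S.sem (CQMap.guard Y b true Δ'))^[n] Δ)

end HQ

/-! The path-sum of `h` is read as one vector `ψ_η` of the quantum memory for each classical history
`η`, namely `HPS.psi`, and `DO(h)(c)` is the sum of the `ψ_η ψ_η†` over the histories `η` with present
row `c` (`HPS.densityOp_eq_sum_psi`). Hence `DO(h)` is positive and its total trace is `|h|²`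
(`HPS.mass_eq_norm_sq`), so that every claim about cq-states reduces to the preservation of the total
trace. All that is used of the scoping conditions is `HPS.Local`: what happens along a path depends
only on the path variables in the support.

A unitary program leaves the histories alone and sends each `ψ_η` to `U ψ_η`, where the operator `U`
depends only on the present classical bits (`QProg.run_step`). For a conditional,
`U = U_p P_b + U_q P_{¬b}`: the sum of path-sums adds the vectors. As the control qubits are not
targets, `U_p` and `U_q` commute with the projectors, and `U` is unitary (`QProg.op_mem_unitaryGroup`).
qhl-cv has no quantum control, so the translation of a unitary program is a case analysis on the
classical memory with one such `U` per case (`Stmt.selectOp`).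

A measurement or an oracle puts a row on the history that is a function of the present row and of the
basis state. Two paths interfere afterwards just when they did before and their new rows agree, which
is the action of the measurement projectors (`HPS.PushStep.densityOp_eq`). In a classical conditional
the two branches must not interfere. Both branches only extend the history of `h`, and neither the
padding of the stacks nor the filling of holes touches that common part (`suffix_mergeHist`). A
history common to both branches would thus come from one history of `h` on which the guard is both
true and false (`Sound.ite`), and the density operators add (`HPS.densityOp_plus`). The structure
`Sound` carries these facts through the induction on programs. Finally, no program is translated to
`abort`, so that the translation is not surjective. -/

namespace HQ

/-! ### Amplitudes and history components -/

namespace HPS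
variable {sg : Sig}

/-- The complex amplitude `s(y) e^{2πi P(y)}` of the path `t`. -/
noncomputable def amp (h : HPS sg) (x : ℕ → Bool) (t : Finset ℕ) : ℂ :=
  (h.s.eval (val x t) : ℂ) * Complex.exp (2 * Real.pi * Complex.I * (h.p.eval (val x t) : ℂ))

/-- `ξ(h)(η)` as a plain function of the basis state. -/
noncomputable def psi (h : HPS sg) (x : ℕ → Bool) (η : History sg) : QState sg → ℂ :=
  ∑ t ∈ h.su.powerset,
    if h.history (val x t) = η then Pi.single (h.qval (val x t)) (h.amp x t) else 0

/-- The histories reached along some path. -/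
def reached (h : HPS sg) (x : ℕ → Bool) : Finset (History sg) :=
  h.su.powerset.image fun t => h.history (val x t)

theorem amp_mul_star (h : HPS sg) (x : ℕ → Bool) (t₁ t₂ : Finset ℕ) :
    (h.s.eval (val x t₁) : ℂ) * (h.s.eval (val x t₂) : ℂ) *
      Complex.exp (2 * Real.pi * Complex.I *
        ((h.p.eval (val x t₁) : ℂ) - (h.p.eval (val x t₂) : ℂ))) =
    h.amp x t₁ * star (h.amp x t₂) := by
  have : 2 * Real.pi * Complex.I * ((h.p.eval (val x t₁) : ℂ) - (h.p.eval (val x t₂) : ℂ)) =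
      2 * Real.pi * Complex.I * (h.p.eval (val x t₁) : ℂ) +
        star (2 * Real.pi * Complex.I * (h.p.eval (val x t₂) : ℂ)) := by
    simp; ring
  rw [this, Complex.exp_add, Complex.star_def, Complex.exp_conj]
  simp only [amp, map_mul, Complex.conj_ofReal]
  ring

theorem densityOp_apply (h : HPS sg) (x : ℕ → Bool) (c : CState sg) :
    h.densityOp x c = ∑ t₁ ∈ h.su.powerset, ∑ t₂ ∈ h.su.powerset,
      if h.history (val x t₁) = h.history (val x t₂) ∧ (h.history (val x t₁)).present = c then
        Matrix.single (h.qval (val x t₁)) (h.qval (val x t₂)) (h.amp x t₁ * star (h.amp x t₂))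
      else 0 := by
  simp only [densityOp, amp_mul_star]

theorem xi_apply (h : HPS sg) (x : ℕ → Bool) (η : History sg) (m : QState sg) :
    h.xi x η m = h.psi x η m := by
  simp only [xi, psi, WithLp.ofLp_sum, Finset.sum_apply]
  refine Finset.sum_congr rfl fun t _ => ?_
  split_ifs <;> simp [amp, Pi.single_apply]

/-- The pairs of paths with a common history are sorted by this history. -/
theorem densityOp_eq_sum_psi (h : HPS sg) (x : ℕ → Bool) (c : CState sg)
    {N : Finset (History sg)} (hN : h.reached x ⊆ N) :
    h.densityOp x c = ∑ η ∈ N,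
      if η.present = c then Matrix.vecMulVec (h.psi x η) (star (h.psi x η)) else 0 := by
  have key : ∀ η, Matrix.vecMulVec (h.psi x η) (star (h.psi x η)) =
      ∑ t₁ ∈ h.su.powerset, ∑ t₂ ∈ h.su.powerset,
        if h.history (val x t₁) = η ∧ h.history (val x t₂) = η then
          Matrix.single (h.qval (val x t₁)) (h.qval (val x t₂)) (h.amp x t₁ * star (h.amp x t₂))
        else 0 := by
    intro η
    ext m m'
    simp only [Matrix.vecMulVec_apply, Pi.star_apply, psi, Finset.sum_apply, star_sum,
      Finset.sum_mul_sum, Matrix.sum_apply]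
    refine Finset.sum_congr rfl fun t₁ _ => Finset.sum_congr rfl fun t₂ _ => ?_
    by_cases h1 : h.history (val x t₁) = η <;> by_cases h2 : h.history (val x t₂) = η <;>
      simp only [h1, h2, if_true, if_false, and_self, and_true, and_false,
        Pi.zero_apply, zero_mul, star_zero, mul_zero, Matrix.zero_apply]
    simp only [Pi.single_apply, Matrix.single_apply]
    by_cases e1 : m = h.qval (val x t₁) <;> by_cases e2 : m' = h.qval (val x t₂) <;>
      simp [e1, e2, eq_comm]
  rw [densityOp_apply]
  simp only [key]
  have : ∀ η ∈ N, (if η.present = c then ∑ t₁ ∈ h.su.powerset, ∑ t₂ ∈ h.su.powerset,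
        if h.history (val x t₁) = η ∧ h.history (val x t₂) = η then
          Matrix.single (h.qval (val x t₁)) (h.qval (val x t₂)) (h.amp x t₁ * star (h.amp x t₂))
        else 0 else 0) = ∑ t₁ ∈ h.su.powerset, ∑ t₂ ∈ h.su.powerset,
        if η = h.history (val x t₁) then
          (if h.history (val x t₁) = h.history (val x t₂) ∧ (h.history (val x t₁)).present = c then
          Matrix.single (h.qval (val x t₁)) (h.qval (val x t₂)) (h.amp x t₁ * star (h.amp x t₂))
          else 0)
        else 0 := by
    intro η _
    by_cases hc : η.present = c
    · rw [if_pos hc]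
      refine Finset.sum_congr rfl fun t₁ _ => Finset.sum_congr rfl fun t₂ _ => ?_
      by_cases h1 : η = h.history (val x t₁)
      · subst h1; simp [hc, eq_comm]
      · rw [if_neg (fun e => h1 e.1.symm), if_neg h1]
    · rw [if_neg hc]
      symm
      refine Finset.sum_eq_zero fun t₁ _ => Finset.sum_eq_zero fun t₂ _ => ?_
      split_ifs with h1 h2
      · exact absurd (h1 ▸ h2.2) hc
      · rfl
      · rfl
  refine ((Finset.sum_congr rfl this).trans (Finset.sum_comm.trans (Finset.sum_congr rfl
    fun t₁ ht₁ => Finset.sum_comm.trans (Finset.sum_congr rfl fun t₂ _ => ?_)))).symm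
  rw [Finset.sum_ite_eq', if_pos (hN (Finset.mem_image_of_mem _ ht₁))]

/-- The total trace of the density operators. -/
noncomputable def mass (h : HPS sg) (x : ℕ → Bool) : ℂ := ∑ c, (h.densityOp x c).trace

theorem mass_eq_norm_sq (h : HPS sg) (x : ℕ → Bool) : h.mass x = ((h.norm x ^ 2 : ℝ) : ℂ) := by
  have h1 : ∀ η, (Matrix.vecMulVec (h.psi x η) (star (h.psi x η))).trace =
      ((‖h.xi x η‖ ^ 2 : ℝ) : ℂ) := by
    intro η
    rw [EuclideanSpace.norm_sq_eq, Matrix.trace]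
    push_cast
    refine Finset.sum_congr rfl fun m _ => ?_
    rw [xi_apply, Matrix.diag_apply, Matrix.vecMulVec_apply, Pi.star_apply, Complex.star_def,
      Complex.mul_conj, Complex.normSq_eq_norm_sq]
    push_cast; rfl
  rw [mass, HPS.norm, Real.sq_sqrt (Finset.sum_nonneg fun _ _ => by positivity)]
  simp only [fun c => h.densityOp_eq_sum_psi x c (Finset.Subset.refl _), Matrix.trace_sum]
  rw [Finset.sum_comm, Complex.ofReal_sum]
  refine Finset.sum_congr rfl fun η _ => ?_
  rw [← h1]
  rw [Finset.sum_eq_single η.present]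
  · simp
  · intro c _ hc; rw [if_neg (Ne.symm hc)]; simp
  · simp

theorem dom_qval (h : HPS sg) (v : SVar → Bool) : (h.qval v).dom = h.alloc.q := by
  simp [QState.dom, alloc, qval]

theorem psi_apply_ne_zero {h : HPS sg} {x : ℕ → Bool} {η : History sg} {m : QState sg}
    (hm : h.psi x η m ≠ 0) : m.dom = h.alloc.q := by
  rw [psi, Finset.sum_apply] at hm
  obtain ⟨t, _, ht⟩ := Finset.exists_ne_zero_of_sum_ne_zero hm
  split_ifs at ht
  · by_cases e : m = h.qval (val x t)
    · rw [e, dom_qval]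
    · exact absurd (Pi.single_eq_of_ne e _) ht
  · simp at ht

theorem densityOp_apply_ne_zero {h : HPS sg} {x : ℕ → Bool} {c : CState sg} {m m' : QState sg}
    (hm : h.densityOp x c m m' ≠ 0) : m.dom = h.alloc.q ∧ m'.dom = h.alloc.q := by
  rw [h.densityOp_eq_sum_psi x c (Finset.Subset.refl _), Matrix.sum_apply] at hm
  obtain ⟨η, _, hη⟩ := Finset.exists_ne_zero_of_sum_ne_zero hm
  split_ifs at hη
  · rw [Matrix.vecMulVec_apply] at hη
    refine ⟨psi_apply_ne_zero (left_ne_zero_of_mul hη), psi_apply_ne_zero (x := x) (η := η) ?_⟩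
    intro e
    exact right_ne_zero_of_mul hη (by simp [e])
  · simp at hη

open scoped ComplexOrder in
theorem isCQState (h : HPS sg) (x : ℕ → Bool) (hm : (h.mass x).re ≤ 1) :
    IsCQState h.alloc.q (h.densityOp x) where
  on_V _ _ _ := densityOp_apply_ne_zero
  posSemidef c := by
    rw [h.densityOp_eq_sum_psi x c (Finset.Subset.refl _)]
    refine Matrix.posSemidef_sum _ fun η _ => ?_
    split_ifs
    · exact Matrix.posSemidef_vecMulVec_self_star _
    · exact Matrix.PosSemidef.zero
  countable_support := Set.to_countable _
  trace_le := hm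

end HPS

/-! ### Scoping -/

theorem BExp.eval_congr {v w : SVar → Bool} : ∀ e : BExp, (∀ a ∈ e.vars, v a = w a) →
    e.eval v = e.eval w
  | .zero, _ => rfl
  | .one, _ => rfl
  | .var a, h => h a (by simp [vars])
  | .and a b, h => by
      rw [eval, eval, a.eval_congr fun i hi => h i (by simp [vars, hi]),
        b.eval_congr fun i hi => h i (by simp [vars, hi])]
  | .xor a b, h => by
      rw [eval, eval, a.eval_congr fun i hi => h i (by simp [vars, hi]),
        b.eval_congr fun i hi => h i (by simp [vars, hi])]

theorem Phase.eval_congr {v w : SVar → Bool} : ∀ e : Phase, (∀ a ∈ e.vars, v a = w a) →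
    e.eval v = e.eval w
  | .zero, _ => rfl
  | .bool b k, h => by rw [eval, eval, b.eval_congr h]
  | .int _ _, _ => rfl
  | .add a b, h => by
      rw [eval, eval, a.eval_congr fun i hi => h i (by simp [vars, hi]),
        b.eval_congr fun i hi => h i (by simp [vars, hi])]
  | .smul i p, h => by rw [eval, eval, p.eval_congr h]
  | .bmul a b, h => by
      rw [eval, eval, a.eval_congr fun i hi => h i (by simp [vars, hi]),
        b.eval_congr fun i hi => h i (by simp [vars, hi])]
  | .neg p, h => by rw [eval, eval, p.eval_congr h]

mutual
theorem Scalar.eval_congr {v w : SVar → Bool} : ∀ e : Scalar, (∀ a ∈ e.vars, v a = w a) →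
    e.eval v = e.eval w
  | .rat _ _, _ => by simp [Scalar.eval]
  | .sqrt s, h => by
      rw [Scalar.eval, Scalar.eval, s.eval_congr fun i hi => h i (by simpa [Scalar.vars] using hi)]
  | .cos a, h => by
      rw [Scalar.eval, Scalar.eval, a.eval_congr fun i hi => h i (by simpa [Scalar.vars] using hi)]
  | .sin a, h => by
      rw [Scalar.eval, Scalar.eval, a.eval_congr fun i hi => h i (by simpa [Scalar.vars] using hi)]
  | .add a b, h => by
      rw [Scalar.eval, Scalar.eval, a.eval_congr fun i hi => h i (by simp [Scalar.vars, hi]),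
        b.eval_congr fun i hi => h i (by simp [Scalar.vars, hi])]
  | .neg s, h => by
      rw [Scalar.eval, Scalar.eval, s.eval_congr fun i hi => h i (by simpa [Scalar.vars] using hi)]
  | .mul a b, h => by
      rw [Scalar.eval, Scalar.eval, a.eval_congr fun i hi => h i (by simp [Scalar.vars, hi]),
        b.eval_congr fun i hi => h i (by simp [Scalar.vars, hi])]
  | .inv s, h => by
      rw [Scalar.eval, Scalar.eval, s.eval_congr fun i hi => h i (by simpa [Scalar.vars] using hi)]
  | .var a, h => by rw [Scalar.eval, Scalar.eval, h a (by simp [Scalar.vars])]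
theorem Angle.eval_congr {v w : SVar → Bool} : ∀ e : Angle, (∀ a ∈ e.vars, v a = w a) →
    e.eval v = e.eval w
  | .dyadic _ _, _ => by simp [Angle.eval]
  | .arccos s, h => by
      rw [Angle.eval, Angle.eval, s.eval_congr fun i hi => h i (by simpa [Angle.vars] using hi)]
  | .arcsin s, h => by
      rw [Angle.eval, Angle.eval, s.eval_congr fun i hi => h i (by simpa [Angle.vars] using hi)]
  | .smul _ a, h => by
      rw [Angle.eval, Angle.eval, a.eval_congr fun i hi => h i (by simpa [Angle.vars] using hi)]
  | .bmul a b, h => by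
      rw [Angle.eval, Angle.eval, a.eval_congr fun i hi => h i (by simp [Angle.vars, hi]),
        b.eval_congr fun i hi => h i (by simp [Angle.vars, hi])]
  | .add a b, h => by
      rw [Angle.eval, Angle.eval, a.eval_congr fun i hi => h i (by simp [Angle.vars, hi]),
        b.eval_congr fun i hi => h i (by simp [Angle.vars, hi])]
  | .neg a, h => by
      rw [Angle.eval, Angle.eval, a.eval_congr fun i hi => h i (by simpa [Angle.vars] using hi)]
end

namespace HPS
variable {sg : Sig}

/-- Along each path, the amplitude and the memory depend only on the path variables of the support.
This is the semantic content of well-scopedness, and all that is needed of it. -/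
structure Local (h : HPS sg) (x : ℕ → Bool) : Prop where
  amp : ∀ t t' : Finset ℕ, t ∩ h.su = t' ∩ h.su → h.amp x t = h.amp x t'
  qval : ∀ t t' : Finset ℕ, t ∩ h.su = t' ∩ h.su → h.qval (val x t) = h.qval (val x t')
  history : ∀ t t' : Finset ℕ, t ∩ h.su = t' ∩ h.su → h.history (val x t) = h.history (val x t')

theorem WellScoped.local {h : HPS sg} (hs : h.WellScoped) (x : ℕ → Bool) : h.Local x := by
  have key : ∀ t t' : Finset ℕ, t ∩ h.su = t' ∩ h.su → ∀ a ∈ h.scope, val x t a = val x t' a := by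
    rintro t t' e a (⟨j, hj, rfl⟩ | ⟨b, hb, ha⟩)
    · have : j ∈ t ∩ h.su ↔ j ∈ t' ∩ h.su := by rw [e]
      simpa [val, hj] using this
    · rcases hs.input_atomic b hb with rfl | rfl | ⟨i, rfl⟩
      · simp [BExp.vars] at ha
      · simp [BExp.vars] at ha
      · simp only [BExp.vars, Finset.mem_singleton] at ha
        subst ha; rfl
  refine ⟨fun t t' e => ?_, fun t t' e => ?_, fun t t' e => ?_⟩
  · rw [HPS.amp, HPS.amp, h.s.eval_congr fun a ha => key t t' e a (hs.scalar_scoped a ha),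
      h.p.eval_congr fun a ha => key t t' e a (hs.phase_scoped a ha)]
  · funext a
    rw [HPS.qval, HPS.qval]
    refine Option.map_congr fun b hb => b.eval_congr fun a' ha' => key t t' e a' ?_
    exact hs.output_scoped b (Or.inl ⟨a, hb⟩) a' ha'
  · rw [HPS.history, HPS.history]
    refine List.map_congr_left fun r hr => funext fun a => ?_
    refine Option.map_congr fun b hb => b.eval_congr fun a' ha' => key t t' e a' ?_
    exact hs.output_scoped b (Or.inr ⟨r, hr, a, hb⟩) a' ha'

end HPS

/-! ### Operators on some of the qubits -/

section Operators
variable {sg : Sig}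

/-- The bits that a memory holds at the cells of `Q`; holes are read as 0. -/
def QState.bits (Q : Finset (QCell sg)) (m : QState sg) : Q → Bool := fun a => (m a.1).getD false

/-- The memory `m` with the cells of `Q` overwritten by `i`. -/
def QState.setBits (Q : Finset (QCell sg)) (m : QState sg) (i : Q → Bool) : QState sg :=
  fun a => if ha : a ∈ Q then some (i ⟨a, ha⟩) else m a

theorem QState.bits_setBits {Q : Finset (QCell sg)} (m : QState sg) (i : Q → Bool) :
    (m.setBits Q i).bits Q = i := by
  funext a; simp [bits, setBits]

theorem QState.mem_dom {m : QState sg} {a : QCell sg} : a ∈ m.dom ↔ (m a).isSome = true := by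
  simp [dom]

theorem QState.eq_some_bits {Q : Finset (QCell sg)} {m : QState sg} (hm : Q ⊆ m.dom) (a : Q) :
    m a.1 = some (m.bits Q a) := by
  obtain ⟨b, hb⟩ := Option.isSome_iff_exists.1 (QState.mem_dom.1 (hm a.2))
  simp [bits, hb]

theorem liftOp_apply {Q : Finset (QCell sg)} (M : Matrix (Q → Bool) (Q → Bool) ℂ)
    (m m' : QState sg) : liftOp Q M m m' =
      if (∀ a, a ∉ Q → m a = m' a) ∧ Q ⊆ m.dom ∧ Q ⊆ m'.dom then M (m.bits Q) (m'.bits Q)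
      else 0 := by
  unfold liftOp
  congr 1
  simp only [Finset.subset_iff, QState.mem_dom, ← forall_and]

theorem liftOp_mul {Q : Finset (QCell sg)} (M N : Matrix (Q → Bool) (Q → Bool) ℂ) :
    liftOp Q M * liftOp Q N = liftOp Q (M * N) := by
  ext m k
  rw [Matrix.mul_apply]
  have off : ∀ (i : Q → Bool) a, a ∉ Q → k.setBits Q i a = k a := fun i a ha => by
    simp [QState.setBits, ha]
  have dom : ∀ i : Q → Bool, Q ⊆ (k.setBits Q i).dom := fun i a ha => by
    simp [QState.mem_dom, QState.setBits, ha]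
  by_cases hc : (∀ a, a ∉ Q → m a = k a) ∧ Q ⊆ m.dom ∧ Q ⊆ k.dom
  · rw [liftOp_apply, if_pos hc, Matrix.mul_apply]
    symm
    refine Fintype.sum_of_injective (fun i => k.setBits Q i) ?_ _ _ ?_ ?_
    · intro i j hij
      have := congrArg (QState.bits Q) hij
      simpa [QState.bits_setBits] using this
    · intro m' hm'
      rw [liftOp_apply N]
      split_ifs with h'
      · refine absurd ⟨m'.bits Q, ?_⟩ hm'
        funext a
        by_cases ha : a ∈ Q
        · simp [QState.setBits, ha, QState.eq_some_bits h'.2.1 ⟨a, ha⟩]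
        · simp [off _ a ha, h'.1 a ha]
      · simp
    · intro i
      rw [liftOp_apply, liftOp_apply, if_pos, if_pos, QState.bits_setBits]
      · exact ⟨off i, dom i, hc.2.2⟩
      · exact ⟨fun a ha => (hc.1 a ha).trans (off i a ha).symm, hc.2.1, dom i⟩
  · rw [liftOp_apply, if_neg hc]
    refine Finset.sum_eq_zero fun m' _ => ?_
    rw [liftOp_apply, liftOp_apply]
    split_ifs with h1 h2
    · exact absurd ⟨fun a ha => (h1.1 a ha).trans (h2.1 a ha), h1.2.1, h2.2.2⟩ hc
    all_goals simp

theorem liftOp_add {Q : Finset (QCell sg)} (M N : Matrix (Q → Bool) (Q → Bool) ℂ) :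
    liftOp Q (M + N) = liftOp Q M + liftOp Q N := by
  ext m k
  simp only [liftOp_apply, Matrix.add_apply]
  split_ifs <;> simp

theorem liftOp_conjTranspose {Q : Finset (QCell sg)} (M : Matrix (Q → Bool) (Q → Bool) ℂ) :
    (liftOp Q M).conjTranspose = liftOp Q M.conjTranspose := by
  ext m k
  rw [Matrix.conjTranspose_apply, liftOp_apply, liftOp_apply]
  have : ((∀ a, a ∉ Q → k a = m a) ∧ Q ⊆ k.dom ∧ Q ⊆ m.dom) ↔
      ((∀ a, a ∉ Q → m a = k a) ∧ Q ⊆ m.dom ∧ Q ⊆ k.dom) := by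
    constructor <;> exact fun h => ⟨fun a ha => (h.1 a ha).symm, h.2.2, h.2.1⟩
  simp only [this]
  split_ifs <;> simp

theorem liftOp_diagonal {Q : Finset (QCell sg)} (d : (Q → Bool) → ℂ) :
    liftOp Q (Matrix.diagonal d) =
      Matrix.diagonal fun m => if Q ⊆ m.dom then d (m.bits Q) else 0 := by
  ext m k
  rw [liftOp_apply]
  by_cases e : m = k
  · subst e; simp
  · rw [Matrix.diagonal_apply_ne _ e]
    split_ifs with h
    · refine Matrix.diagonal_apply_ne _ fun eb => e (funext fun a => ?_)
      by_cases ha : a ∈ Q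
      · rw [QState.eq_some_bits h.2.1 ⟨a, ha⟩, QState.eq_some_bits h.2.2 ⟨a, ha⟩, eb]
      · exact h.1 a ha
    · rfl

theorem liftOp_one_mulVec {Q : Finset (QCell sg)} {f : QState sg → ℂ}
    (hf : ∀ m, f m ≠ 0 → Q ⊆ m.dom) : (liftOp Q 1).mulVec f = f := by
  rw [← Matrix.diagonal_one, liftOp_diagonal]
  funext m
  rw [Matrix.mulVec_diagonal]
  by_cases h : f m = 0
  · simp [h]
  · simp [hf m h]

theorem liftOp_one_mul {Q : Finset (QCell sg)} {A : Matrix (QState sg) (QState sg) ℂ}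
    (hA : ∀ m m', A m m' ≠ 0 → Q ⊆ m.dom) : liftOp Q 1 * A = A := by
  rw [← Matrix.diagonal_one, liftOp_diagonal]
  ext m m'
  rw [Matrix.diagonal_mul]
  by_cases h : A m m' = 0
  · simp [h]
  · simp [hA m m' h]

/-! ### Gates -/

/-- The one-bit operator `G` on the component `a` of a tuple of bits. -/
def gateOn {I : Type*} [Fintype I] [DecidableEq I] (a : I) (G : Matrix Bool Bool ℂ) :
    Matrix (I → Bool) (I → Bool) ℂ :=
  fun i j => if ∀ b, b ≠ a → i b = j b then G (i a) (j a) else 0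

section gateOn
variable {I : Type*} [Fintype I] [DecidableEq I] (a : I)

theorem gateOn_mul (G K : Matrix Bool Bool ℂ) : gateOn a G * gateOn a K = gateOn a (G * K) := by
  ext i k
  rw [Matrix.mul_apply]
  have off : ∀ (d : Bool) b, b ≠ a → Function.update k a d b = k b := fun d b hb => by simp [hb]
  by_cases hc : ∀ b, b ≠ a → i b = k b
  · rw [gateOn, if_pos hc, Matrix.mul_apply]
    symm
    refine Fintype.sum_of_injective (fun d => Function.update k a d) ?_ _ _ ?_ ?_
    · exact Function.update_injective k a
    · intro j hj
      simp only [gateOn]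
      rw [if_neg (c := ∀ b, b ≠ a → j b = k b), mul_zero]
      refine fun h => hj ⟨j a, funext fun b => ?_⟩
      by_cases hb : b = a
      · subst hb; simp
      · simp [hb, h b hb]
    · intro d
      simp only [gateOn]
      rw [if_pos (fun b hb => (hc b hb).trans (off d b hb).symm), if_pos (off d)]
      simp
  · rw [gateOn, if_neg hc]
    refine Finset.sum_eq_zero fun j _ => ?_
    simp only [gateOn]
    split_ifs with h1 h2
    · exact absurd (fun b hb => (h1 b hb).trans (h2 b hb)) hc
    all_goals simp

theorem gateOn_one : gateOn a (1 : Matrix Bool Bool ℂ) = 1 := by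
  ext i j
  rw [gateOn, Matrix.one_apply, Matrix.one_apply]
  by_cases e : i = j
  · subst e; simp
  · rw [if_neg e]
    split_ifs with h1 h2
    · refine absurd (funext fun b => ?_) e
      by_cases hb : b = a
      · rw [hb, h2]
      · exact h1 b hb
    all_goals rfl

theorem gateOn_conjTranspose (G : Matrix Bool Bool ℂ) :
    (gateOn a G).conjTranspose = gateOn a G.conjTranspose := by
  ext i j
  simp only [Matrix.conjTranspose_apply, gateOn]
  have : (∀ b, b ≠ a → j b = i b) ↔ ∀ b, b ≠ a → i b = j b :=
    forall_congr' fun b => imp_congr_right fun _ => eq_comm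
  simp only [this]
  split_ifs <;> simp

theorem gateOn_mem_unitaryGroup {G : Matrix Bool Bool ℂ} (hG : G ∈ Matrix.unitaryGroup Bool ℂ) :
    gateOn a G ∈ Matrix.unitaryGroup (I → Bool) ℂ := by
  rw [Matrix.mem_unitaryGroup_iff, Matrix.star_eq_conjTranspose] at hG ⊢
  rw [gateOn_conjTranspose, gateOn_mul, hG, gateOn_one]

end gateOn

/-- The matrices of the gates. -/
noncomputable def Gate.mat : Gate → Matrix Bool Bool ℂ
  | .H => Matrix.of fun i j => ((Real.sqrt 2 : ℝ) : ℂ)⁻¹ * if i && j then -1 else 1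
  | .X => Matrix.of fun i j => if i = !j then 1 else 0
  | .Z k => Matrix.diagonal fun i =>
      if i then Complex.exp (2 * Real.pi * Complex.I * ((1 / 2 ^ k : ℝ) : ℂ)) else 1

theorem Gate.mat_mem_unitaryGroup (G : Gate) : G.mat ∈ Matrix.unitaryGroup Bool ℂ := by
  rw [Matrix.mem_unitaryGroup_iff, Matrix.star_eq_conjTranspose]
  have h2 : ((Real.sqrt 2 : ℝ) : ℂ)⁻¹ * ((Real.sqrt 2 : ℝ) : ℂ)⁻¹ = 1 / 2 := by
    rw [← mul_inv, ← Complex.ofReal_mul, Real.mul_self_sqrt (by norm_num)]; norm_num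
  cases G with
  | H =>
    ext i j
    cases i <;> cases j <;>
      simp [Matrix.mul_apply, mat, Complex.conj_ofReal, h2]; norm_num
  | X =>
    ext i j
    cases i <;> cases j <;> simp [Matrix.mul_apply, mat]
  | Z k =>
    rw [mat, Matrix.diagonal_conjTranspose, Matrix.diagonal_mul_diagonal, ← Matrix.diagonal_one]
    congr 1
    funext i
    cases i
    · simp
    · simp only [if_true, Pi.star_apply, Complex.star_def, Complex.mul_conj,
        Complex.normSq_eq_norm_sq]
      rw [show 2 * (Real.pi : ℂ) * Complex.I * ((1 / 2 ^ k : ℝ) : ℂ) =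
        ((2 * Real.pi * (1 / 2 ^ k) : ℝ) : ℂ) * Complex.I by push_cast; ring,
        Complex.norm_exp_ofReal_mul_I]
      simp

/-- The action of a gate on a basis state. -/
theorem liftOp_gateOn_mulVec_single {Q : Finset (QCell sg)} (a : Q) (G : Matrix Bool Bool ℂ)
    {m : QState sg} (hm : Q ⊆ m.dom) :
    (liftOp Q (gateOn a G)).mulVec (Pi.single m 1) =
      ∑ d, Pi.single (Function.update m a.1 (some d)) (G d ((m a.1).getD false)) := by
  funext k
  rw [Matrix.mulVec_single_one, Matrix.col_apply, Finset.sum_apply, liftOp_apply]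
  by_cases hk : ∃ d, k = Function.update m a.1 (some d)
  · obtain ⟨d, rfl⟩ := hk
    rw [Finset.sum_eq_single d, Pi.single_eq_same, if_pos, gateOn, if_pos]
    · simp [QState.bits]
    · intro b hb
      have : (b : QCell sg) ≠ a := fun e => hb (Subtype.ext e)
      simp [QState.bits, this]
    · refine ⟨fun b hb => ?_, fun b hb => ?_, hm⟩
      · have : b ≠ a.1 := fun e => hb (e ▸ a.2)
        simp [this]
      · rw [QState.mem_dom]
        by_cases e : b = a.1
        · subst e; simp
        · rw [Function.update_of_ne e]; exact QState.mem_dom.1 (hm hb)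
    · intro d' _ hd'
      refine Pi.single_eq_of_ne (fun e => hd' ?_) _
      have := congrFun e a.1
      simpa [eq_comm] using this
    · simp
  · rw [Finset.sum_eq_zero fun d _ => Pi.single_eq_of_ne (fun e => hk ⟨d, e⟩) _]
    split_ifs with h
    · rw [gateOn, if_neg]
      refine fun hb => hk ⟨k.bits Q a, funext fun b => ?_⟩
      by_cases e : b = a.1
      · subst e
        rw [Function.update_self, QState.eq_some_bits h.2.1]
      · rw [Function.update_of_ne e]
        by_cases hbQ : b ∈ Q
        · have := hb ⟨b, hbQ⟩ fun e' => e (congrArg Subtype.val e')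
          rw [QState.eq_some_bits h.2.1 ⟨b, hbQ⟩, this, ← QState.eq_some_bits hm ⟨b, hbQ⟩]
        · exact h.1 b hbQ
    · rfl

end Operators

/-! ### Boolean expressions -/

/-- The value of a classical Boolean on a full classical memory. -/
def CBool.value {sg : Sig} (ρ : Env) (v : CCell sg → Bool) : CBool sg → Bool
  | .zero => false
  | .one => true
  | .reg C => (C.cells ρ).all v
  | .xor a b => Bool.xor (a.value ρ v) (b.value ρ v)
  | .and a b => a.value ρ v && b.value ρ v
  | .cond a b c => if a.value ρ v then b.value ρ v else c.value ρ v

/-- The value of a Boolean on full quantum and classical memories. -/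
def QBool.value {sg : Sig} (ρ : Env) (w : QCell sg → Bool) (v : CCell sg → Bool) :
    QBool sg → Bool
  | .zero => false
  | .one => true
  | .reg Q => (Q.cells ρ).all w
  | .ofC b => b.value ρ v
  | .xor a b => Bool.xor (a.value ρ w v) (b.value ρ w v)
  | .and a b => a.value ρ w v && b.value ρ w v
  | .cond a b c => if a.value ρ w v then b.value ρ w v else c.value ρ w v

theorem BExp.eval_cond (v : SVar → Bool) (a b c : BExp) :
    (BExp.cond a b c).eval v = if a.eval v then b.eval v else c.eval v := by
  simp only [cond, eval]
  cases a.eval v <;> cases b.eval v <;> cases c.eval v <;> rfl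

theorem BExp.eval_conj (v : SVar → Bool) (l : List BExp) :
    (BExp.conj l).eval v = l.all (BExp.eval v) := by
  induction l with
  | nil => rfl
  | cons b l ih => rw [List.all_cons, ← ih]; rfl

theorem BExp.eval_ofFun (v : SVar → Bool) (l : List BExp) (f : List Bool → Bool) :
    (BExp.ofFun l f).eval v = f (l.map (BExp.eval v)) := by
  induction l generalizing f with
  | nil => rw [ofFun]; cases h : f [] <;> simp [eval, h]
  | cons b l ih =>
    rw [ofFun, eval_cond, ih, ih, List.map_cons]
    cases b.eval v <;> rfl

/-- The bits that a classical memory holds; holes are read as 0. -/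
def CState.bits {sg : Sig} (σ : CState sg) : CCell sg → Bool := fun a => (σ a).getD false

theorem History.present_map {sg : Sig} (c : List (CRow sg)) (v : SVar → Bool) (a : CCell sg) :
    History.present (c.map fun r a => (r a).map (BExp.eval v)) a =
      (HMem.top c a).map (BExp.eval v) := by
  cases c <;> rfl

namespace HPS
variable {sg : Sig} (h : HPS sg) (v : SVar → Bool)

theorem present_history (a : CCell sg) :
    (h.history v).present a = (HMem.top h.o.c a).map (BExp.eval v) :=
  History.present_map _ _ _

theorem eval_curQ (a : QCell sg) : (h.curQ a).eval v = (h.qval v a).getD false := by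
  unfold curQ qval
  cases h.o.q a <;> rfl

theorem eval_curC (a : CCell sg) : (h.curC a).eval v = (h.history v).present.bits a := by
  rw [CState.bits, present_history]
  unfold curC
  cases HMem.top h.o.c a <;> rfl

end HPS

theorem CBool.eval_sym {sg : Sig} (ρ : Env) (h : HPS sg) (v : SVar → Bool) (b : CBool sg) :
    (b.sym ρ h).eval v = b.value ρ (h.history v).present.bits := by
  induction b with
  | zero => rfl
  | one => rfl
  | reg C =>
    rw [sym, BExp.eval_conj, List.all_map, value]
    congr 1; funext a; exact h.eval_curC v a
  | xor a b iha ihb => rw [sym, BExp.eval, iha, ihb, value]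
  | and a b iha ihb => rw [sym, BExp.eval, iha, ihb, value]
  | cond a b c iha ihb ihc => rw [sym, BExp.eval_cond, iha, ihb, ihc, value]

theorem QBool.eval_sym {sg : Sig} (ρ : Env) (h : HPS sg) (v : SVar → Bool) (b : QBool sg) :
    (b.sym ρ h).eval v =
      b.value ρ (fun a => (h.qval v a).getD false) (h.history v).present.bits := by
  induction b with
  | zero => rfl
  | one => rfl
  | reg Q =>
    rw [sym, BExp.eval_conj, List.all_map, value]
    congr 1; funext a; exact h.eval_curQ v a
  | ofC b => exact b.eval_sym ρ h v
  | xor a b iha ihb => rw [sym, BExp.eval, iha, ihb, value]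
  | and a b iha ihb => rw [sym, BExp.eval, iha, ihb, value]
  | cond a b c iha ihb ihc => rw [sym, BExp.eval_cond, iha, ihb, ihc, value]

theorem QBool.value_congr {sg : Sig} (ρ : Env) {w w' : QCell sg → Bool} (v : CCell sg → Bool)
    (b : QBool sg) (hw : ∀ a ∈ b.qcells ρ, w a = w' a) : b.value ρ w v = b.value ρ w' v := by
  induction b with
  | zero => rfl
  | one => rfl
  | reg Q =>
    rw [value, value, Bool.eq_iff_iff, List.all_eq_true, List.all_eq_true]
    refine forall₂_congr fun a ha => ?_
    rw [hw a (by simpa [qcells] using ha)]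
  | ofC b => rfl
  | xor a b iha ihb =>
    rw [value, value, iha fun i hi => hw i (by simp [qcells, hi]),
      ihb fun i hi => hw i (by simp [qcells, hi])]
  | and a b iha ihb =>
    rw [value, value, iha fun i hi => hw i (by simp [qcells, hi]),
      ihb fun i hi => hw i (by simp [qcells, hi])]
  | cond a b c iha ihb ihc =>
    rw [value, value, iha fun i hi => hw i (by simp [qcells, hi]),
      ihb fun i hi => hw i (by simp [qcells, hi]), ihc fun i hi => hw i (by simp [qcells, hi])]

theorem Scalar.eval_lift (v : SVar → Bool) (b : BExp) :
    (Scalar.lift b).eval v = if b.eval v then 1 else 0 := by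
  induction b with
  | zero => simp [lift, Scalar.eval, BExp.eval]
  | one => simp [lift, Scalar.eval, BExp.eval]
  | var a =>
    simp only [lift, Scalar.eval, BExp.eval]
    by_cases ha : v a = true <;> simp [ha]
  | and a b iha ihb =>
    simp only [lift, Scalar.eval, BExp.eval, iha, ihb]
    by_cases ha : a.eval v = true <;> by_cases hb : b.eval v = true <;> simp [ha, hb]
  | xor a b iha ihb =>
    simp only [lift, Scalar.eval, BExp.eval, iha, ihb]
    by_cases ha : a.eval v = true <;> by_cases hb : b.eval v = true <;> norm_num [ha, hb]


/-! ### Sums over paths -/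

namespace HPS
variable {sg : Sig}

/-- The sum over the paths of a function of the amplitude, the history and the basis state. -/
noncomputable def pathSum {M : Type*} [AddCommMonoid M] (h : HPS sg) (x : ℕ → Bool)
    (F : ℂ → History sg → QState sg → M) : M :=
  ∑ t ∈ h.su.powerset, F (h.amp x t) (h.history (val x t)) (h.qval (val x t))

theorem psi_eq_pathSum (h : HPS sg) (x : ℕ → Bool) (η : History sg) :
    h.psi x η = h.pathSum x fun α k q => if k = η then Pi.single q α else 0 := rfl

theorem densityOp_eq_pathSum (h : HPS sg) (x : ℕ → Bool) (c : CState sg) :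
    h.densityOp x c = h.pathSum x fun α k q => h.pathSum x fun α' k' q' =>
      if k = k' ∧ k.present = c then Matrix.single q q' (α * star α') else 0 :=
  h.densityOp_apply x c

end HPS

/-! ### Sums of hybrid path-sums -/

section Merge
variable {α β : Type*}

/-- Extension of a stack to length `n` by repetition of its top element; `d` is the top element of
the empty stack. -/
def padWith (n : ℕ) (d : α) (l : List α) : List α :=
  List.replicate (n - l.length) (l.headD d) ++ l

theorem map_padWith (f : α → β) (n : ℕ) (d : α) (l : List α) :
    (padWith n d l).map f = padWith n (f d) (l.map f) := by
  cases l <;> simp [padWith]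

theorem length_padWith {n : ℕ} {d : α} {l : List α} (h : l.length ≤ n) :
    (padWith n d l).length = n := by
  simp [padWith, h]

theorem headD_padWith (n : ℕ) (d : α) (l : List α) : (padWith n d l).headD d = l.headD d := by
  unfold padWith
  cases n - l.length <;> simp [List.replicate_succ]

theorem suffix_padWith (n : ℕ) (d : α) (l : List α) : l <:+ padWith n d l :=
  List.suffix_append _ _

theorem padWith_of_length_le {n : ℕ} {d : α} {l : List α} (h : n ≤ l.length) :
    padWith n d l = l := by
  simp [padWith, Nat.sub_eq_zero_of_le h]

theorem zipWith_suffix {γ : Type*} (f : α → β → γ) {l₁ l₂ : List α} {m₁ m₂ : List β}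
    (hl : l₁ <:+ l₂) (hm : m₁ <:+ m₂) (h₁ : l₁.length = m₁.length) (h₂ : l₂.length = m₂.length) :
    List.zipWith f l₁ m₁ <:+ List.zipWith f l₂ m₂ := by
  obtain ⟨a, rfl⟩ := hl
  obtain ⟨b, rfl⟩ := hm
  rw [List.zipWith_append]
  · exact List.suffix_append _ _
  · simp only [List.length_append] at h₂; omega

theorem suffix_unique {l₁ l₂ l : List α} (h₁ : l₁ <:+ l) (h₂ : l₂ <:+ l)
    (h : l₁.length = l₂.length) : l₁ = l₂ :=
  (List.suffix_of_suffix_length_le h₁ h₂ h.le).eq_of_length h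

variable {sg : Sig}

/-- The sets of non-hole addresses of the rows of a stack. -/
abbrev Shape (sg : Sig) := List (CCell sg → Bool)

/-- The non-hole addresses of a row. -/
def rowShape {γ : Type*} (r : CCell sg → Option γ) : CCell sg → Bool := fun a => (r a).isSome

/-- The row `r`, with holes at the addresses of `s` filled by 0. -/
def fillRow (s : CCell sg → Bool) (r : CState sg) : CState sg :=
  fun a => if s a then some ((r a).getD false) else r a

/-- The history that the sum of two path-sums has along the paths of one summand: `η` is the history
in this summand, and `s` the shape of the histories of the other one. -/
def mergeHist (s : Shape sg) (η : History sg) : History sg :=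
  List.zipWith fillRow (padWith (max s.length η.length) (fun _ => false) s)
    (padWith (max s.length η.length) (fun _ => none) η)

theorem fillRow_rowShape (r : CState sg) : fillRow (rowShape r) r = r := by
  funext a
  cases h : r a <;> simp [fillRow, rowShape, h]

theorem fillRow_injective {s : CCell sg → Bool} {r r' : CState sg} (hr : rowShape r = rowShape r')
    (h : fillRow s r = fillRow s r') : r = r' := by
  funext a
  have h1 := congrFun hr a
  have h2 := congrFun h a
  simp only [fillRow, rowShape] at h1 h2
  cases e : r a <;> cases e' : r' a <;> simp_all

theorem zipWith_fillRow_self (η : History sg) :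
    List.zipWith fillRow (η.map rowShape) η = η := by
  induction η with
  | nil => rfl
  | cons r η ih => simp [fillRow_rowShape, ih]

theorem zipWith_fillRow_injective : ∀ (s : Shape sg) (η η' : History sg),
    η.map rowShape = η'.map rowShape → η.length ≤ s.length →
    List.zipWith fillRow s η = List.zipWith fillRow s η' → η = η'
  | _, [], [], _, _, _ => rfl
  | _, [], _ :: _, h, _, _ => by simp at h
  | _, _ :: _, [], h, _, _ => by simp at h
  | [], _ :: _, _ :: _, _, h, _ => by simp at h
  | a :: s, r :: η, r' :: η', h, hl, he => by
    simp only [List.map_cons, List.cons.injEq, List.zipWith_cons_cons, List.length_cons,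
      Nat.add_le_add_iff_right] at h hl he
    rw [fillRow_injective h.1 he.1, zipWith_fillRow_injective s η η' h.2 hl he.2]

theorem mergeHist_injective {s : Shape sg} {η η' : History sg}
    (hs : η.map rowShape = η'.map rowShape) (h : mergeHist s η = mergeHist s η') : η = η' := by
  have hl : η.length = η'.length := by simpa using congrArg List.length hs
  unfold mergeHist at h
  rw [← hl] at h
  have := zipWith_fillRow_injective _ _ _ ?_ ?_ h
  · exact suffix_unique (suffix_padWith _ _ η) (this ▸ suffix_padWith _ _ η') hl
  · rw [map_padWith, map_padWith, hs]
  · rw [length_padWith (le_max_right _ _), length_padWith (le_max_left _ _)]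

theorem mergeHist_self (η : History sg) : mergeHist (η.map rowShape) η = η := by
  unfold mergeHist
  rw [padWith_of_length_le, padWith_of_length_le, zipWith_fillRow_self]
  all_goals simp

/-- Padding happens on top and the rows of the common past have the same holes on both sides, so that
this past is kept. -/
theorem suffix_mergeHist {s : Shape sg} {β η : History sg} (hη : β <:+ η)
    (hs : β.map rowShape <:+ s) : β <:+ mergeHist s η := by
  have := zipWith_suffix fillRow (hs.trans (suffix_padWith (max s.length η.length) (fun _ => false) s))
    (hη.trans (suffix_padWith (max s.length η.length) (fun _ => none) η)) (by simp)
    (by rw [length_padWith (le_max_right _ _), length_padWith (le_max_left _ _)])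
  rwa [zipWith_fillRow_self] at this

/-- If the present rows of both summands have the same shape, then no hole of the present row is filled. -/
theorem present_mergeHist {s : Shape sg} {η : History sg}
    (h : s.headD (fun _ => false) = rowShape η.present) : (mergeHist s η).present = η.present := by
  have hs : (padWith (max s.length η.length) (fun _ => false) s).headD (fun _ => false) =
      rowShape η.present := by rw [headD_padWith, h]
  have he : (padWith (max s.length η.length) (fun _ => none) η).headD (fun _ => none) =
      η.present := headD_padWith _ _ _
  have hl : (padWith (max s.length η.length) (fun _ => false) s).length =
      (padWith (max s.length η.length) (fun _ => none) η).length := by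
    rw [length_padWith (le_max_right _ _), length_padWith (le_max_left _ _)]
  unfold mergeHist
  generalize padWith (max s.length η.length) (fun _ => false) s = S at *
  generalize padWith (max s.length η.length) (fun _ => none) η = N at *
  match S, N with
  | [], [] => exact he
  | [], _ :: _ => simp at hl
  | _ :: _, [] => simp at hl
  | a :: S, r :: N =>
    simp only [List.headD_cons] at hs he
    rw [hs, he]
    exact fillRow_rowShape _

end Merge

namespace HPS
variable {sg : Sig}

/-- The shape of the classical stack. -/
def cshape (h : HPS sg) : Shape sg := h.o.c.map rowShape

theorem map_rowShape_history (h : HPS sg) (v : SVar → Bool) :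
    (h.history v).map rowShape = h.cshape := by
  simp only [history, cshape, List.map_map]
  refine List.map_congr_left fun r _ => funext fun a => ?_
  simp [rowShape]

theorem length_history (h : HPS sg) (v : SVar → Bool) : (h.history v).length = h.cshape.length := by
  simp [history, cshape]

theorem rowShape_present_history (h : HPS sg) (v : SVar → Bool) :
    rowShape (h.history v).present = fun a => decide (a ∈ h.alloc.c) := by
  funext a
  simp [rowShape, alloc, present_history]

theorem headD_cshape (h : HPS sg) :
    h.cshape.headD (fun _ => false) = fun a => decide (a ∈ h.alloc.c) := by
  funext a
  obtain ⟨_, _, _, ⟨_, c⟩, _⟩ := h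
  cases c <;> simp [cshape, alloc, HMem.top, rowShape]

/-- The path variable on which the sum of two path-sums branches. -/
def branchVar (h₁ h₂ : HPS sg) : ℕ := fresh (h₁.su ∪ h₂.su)

theorem fresh_notMem (s : Finset ℕ) : fresh s ∉ s := fun h => by
  have := Finset.le_sup (f := id) h
  simp only [fresh, id] at this
  omega

theorem eval_mergeCell (v : SVar → Bool) (e : BExp) (a b : Option BExp) :
    (mergeCell e a b).map (BExp.eval v) =
      if e.eval v then (if b.isSome then some ((a.map (BExp.eval v)).getD false)
        else a.map (BExp.eval v))
      else (if a.isSome then some ((b.map (BExp.eval v)).getD false)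
        else b.map (BExp.eval v)) := by
  cases a <;> cases b <;> simp [mergeCell, BExp.eval_cond, BExp.eval] <;>
    cases e.eval v <;> simp

theorem isSome_mergeCell (e : BExp) (a b : Option BExp) :
    (mergeCell e a b).isSome = (a.isSome || b.isSome) := by
  cases a <;> cases b <;> simp [mergeCell]

theorem eval_filterBy (v : SVar → Bool) (J : Finset ℕ) (s : Scalar) :
    (Scalar.filterBy J s).eval v = if ∀ j ∈ J, v (Sum.inr j) = true then s.eval v else 0 := by
  have key : ∀ l : List ℕ,
      (l.foldr (fun j r => Scalar.mul (Scalar.var (Sum.inr j)) r) s).eval v =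
        if ∀ j ∈ l, v (Sum.inr j) = true then s.eval v else 0 := by
    intro l
    induction l with
    | nil => simp
    | cons j l ih =>
      rw [List.foldr_cons, Scalar.eval, ih, Scalar.eval]
      by_cases hj : v (Sum.inr j) = true <;> simp [hj]
  rw [Scalar.filterBy, key]
  simp

section plus
variable (h₁ h₂ : HPS sg) (x : ℕ → Bool) (t : Finset ℕ)

theorem plus_su : (h₁.plus h₂).su = insert (branchVar h₁ h₂) (h₁.su ∪ h₂.su) := rfl

theorem plus_amp : (h₁.plus h₂).amp x t =
    if branchVar h₁ h₂ ∈ t then (if h₂.su \ h₁.su ⊆ t then h₁.amp x t else 0)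
    else (if h₁.su \ h₂.su ⊆ t then h₂.amp x t else 0) := by
  have hs : ∀ J : Finset ℕ, (∀ j ∈ J, val x t (Sum.inr j) = true) ↔ J ⊆ t := fun J => by
    simp [val, Finset.subset_iff]
  have hb : val x t (Sum.inr (branchVar h₁ h₂)) = decide (branchVar h₁ h₂ ∈ t) := rfl
  have hs' : (h₁.plus h₂).s.eval (val x t) =
      if branchVar h₁ h₂ ∈ t then (if h₂.su \ h₁.su ⊆ t then h₁.s.eval (val x t) else 0)
      else (if h₁.su \ h₂.su ⊆ t then h₂.s.eval (val x t) else 0) := by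
    change (Scalar.cond (BExp.var (Sum.inr (branchVar h₁ h₂))) _ _).eval _ = _
    simp only [Scalar.cond, Scalar.eval, Scalar.eval_lift, eval_filterBy, hs, BExp.eval, hb]
    by_cases hy : branchVar h₁ h₂ ∈ t <;> simp [hy]
  have hp' : (h₁.plus h₂).p.eval (val x t) =
      if branchVar h₁ h₂ ∈ t then h₁.p.eval (val x t) else h₂.p.eval (val x t) := by
    change (Phase.cond (BExp.var (Sum.inr (branchVar h₁ h₂))) _ _).eval _ = _
    simp only [Phase.cond, Phase.eval, BExp.eval, hb]
    by_cases hy : branchVar h₁ h₂ ∈ t <;> simp [hy]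
  simp only [amp, hs', hp']
  split_ifs <;> simp

theorem plus_history : (h₁.plus h₂).history (val x t) =
    if branchVar h₁ h₂ ∈ t then mergeHist h₂.cshape (h₁.history (val x t))
    else mergeHist h₁.cshape (h₂.history (val x t)) := by
  have hb : (BExp.var (Sum.inr (branchVar h₁ h₂))).eval (val x t) =
      decide (branchVar h₁ h₂ ∈ t) := rfl
  have e₁ : mergeHist h₂.cshape (h₁.history (val x t)) = List.zipWith
      (fun r₁ r₂ => fillRow (rowShape r₂) (fun a => (r₁ a).map (BExp.eval (val x t))))
      (padTo (max h₁.o.c.length h₂.o.c.length) h₁.o.c)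
      (padTo (max h₁.o.c.length h₂.o.c.length) h₂.o.c) := by
    rw [mergeHist, length_history]
    simp only [cshape, List.length_map]
    rw [max_comm, history, show (fun _ : CCell sg => false) = rowShape (γ := BExp) (fun _ => none)
      from rfl, ← map_padWith, show (fun _ : CCell sg => (none : Option Bool)) =
      (fun a => ((fun _ => none : CRow sg) a).map (BExp.eval (val x t))) from rfl,
      ← map_padWith (fun (r : CRow sg) a => (r a).map (BExp.eval (val x t))),
      List.zipWith_map, List.zipWith_comm]
    rfl
  have e₂ : mergeHist h₁.cshape (h₂.history (val x t)) = List.zipWith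
      (fun r₁ r₂ => fillRow (rowShape r₁) (fun a => (r₂ a).map (BExp.eval (val x t))))
      (padTo (max h₁.o.c.length h₂.o.c.length) h₁.o.c)
      (padTo (max h₁.o.c.length h₂.o.c.length) h₂.o.c) := by
    rw [mergeHist, length_history]
    simp only [cshape, List.length_map]
    rw [history, show (fun _ : CCell sg => false) = rowShape (γ := BExp) (fun _ => none)
      from rfl, ← map_padWith, show (fun _ : CCell sg => (none : Option Bool)) =
      (fun a => ((fun _ => none : CRow sg) a).map (BExp.eval (val x t))) from rfl,
      ← map_padWith (fun (r : CRow sg) a => (r a).map (BExp.eval (val x t))),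
      List.zipWith_map]
    rfl
  rw [e₁, e₂]
  change (List.zipWith (fun (r₁ r₂ : CRow sg) a =>
    mergeCell (BExp.var (Sum.inr (branchVar h₁ h₂))) (r₁ a) (r₂ a)) _ _).map _ = _
  rw [List.map_zipWith]
  simp only [eval_mergeCell, hb]
  by_cases hy : branchVar h₁ h₂ ∈ t <;> simp only [hy, decide_true, decide_false, if_true, if_false,
    Bool.false_eq_true] <;> rfl

theorem plus_qval (hq : h₁.alloc.q = h₂.alloc.q) : (h₁.plus h₂).qval (val x t) =
    if branchVar h₁ h₂ ∈ t then h₁.qval (val x t) else h₂.qval (val x t) := by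
  have hb : (BExp.var (Sum.inr (branchVar h₁ h₂))).eval (val x t) =
      decide (branchVar h₁ h₂ ∈ t) := rfl
  funext a
  have ha : (h₁.o.q a).isSome = (h₂.o.q a).isSome := by
    have := congrArg (a ∈ ·) hq
    rw [Bool.eq_iff_iff]
    simpa [alloc] using this
  change (mergeCell (BExp.var (Sum.inr (branchVar h₁ h₂))) (h₁.o.q a) (h₂.o.q a)).map _ = _
  rw [eval_mergeCell, hb]
  by_cases hy : branchVar h₁ h₂ ∈ t <;> simp only [hy, decide_true, decide_false, if_true, if_false,
    Bool.false_eq_true, qval]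
  · rw [← ha]; cases h₁.o.q a <;> simp
  · rw [ha]; cases h₂.o.q a <;> simp

theorem plus_alloc (ha : h₁.alloc = h₂.alloc) : (h₁.plus h₂).alloc = h₁.alloc := by
  have hq : (h₁.plus h₂).alloc.q = h₁.alloc.q := by
    have e := congrArg Alloc.q ha
    ext a
    have := congrArg (a ∈ ·) e
    simp only [alloc, Finset.mem_filter, Finset.mem_univ, true_and] at this ⊢
    change (mergeCell (BExp.var (Sum.inr (branchVar h₁ h₂))) (h₁.o.q a) (h₂.o.q a)).isSome = _ ↔ _
    rw [isSome_mergeCell, Bool.or_eq_true, ← this, or_self]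
  have hc : (h₁.plus h₂).alloc.c = h₁.alloc.c := by
    have h1 := (h₁.plus h₂).rowShape_present_history (val (fun _ => false) {branchVar h₁ h₂})
    rw [plus_history, if_pos (Finset.mem_singleton_self _), present_mergeHist,
      rowShape_present_history] at h1
    · ext a
      have := congrFun h1 a
      simpa using this.symm
    · rw [rowShape_present_history, headD_cshape, ha]
  cases e₁ : (h₁.plus h₂).alloc
  cases e₂ : h₁.alloc
  rw [e₁, e₂] at hq hc
  simp only at hq hc
  rw [hq, hc]

variable {h₁ h₂ x}

theorem Local.plus (l₁ : h₁.Local x) (l₂ : h₂.Local x) (hq : h₁.alloc.q = h₂.alloc.q) :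
    (h₁.plus h₂).Local x := by
  have inter : ∀ {s : Finset ℕ} {t t' : Finset ℕ},
      t ∩ (h₁.plus h₂).su = t' ∩ (h₁.plus h₂).su → s ⊆ (h₁.plus h₂).su → t ∩ s = t' ∩ s := by
    intro s t t' e hs
    rw [← Finset.inter_eq_right.2 hs, ← Finset.inter_assoc, e, Finset.inter_assoc]
  have sub : ∀ {s : Finset ℕ} {t t' : Finset ℕ},
      t ∩ (h₁.plus h₂).su = t' ∩ (h₁.plus h₂).su → s ⊆ (h₁.plus h₂).su → (s ⊆ t ↔ s ⊆ t') := by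
    intro s t t' e hs
    have h : ∀ u : Finset ℕ, s ⊆ u ↔ u ∩ s = s := fun u => Finset.inter_eq_right.symm
    rw [h, h, inter e hs]
  have s₁ : h₁.su ⊆ (h₁.plus h₂).su := by
    rw [plus_su]; exact Finset.subset_union_left.trans (Finset.subset_insert _ _)
  have s₂ : h₂.su ⊆ (h₁.plus h₂).su := by
    rw [plus_su]; exact Finset.subset_union_right.trans (Finset.subset_insert _ _)
  have hy : {branchVar h₁ h₂} ⊆ (h₁.plus h₂).su := by rw [plus_su]; simp
  have mem : ∀ {t t' : Finset ℕ}, t ∩ (h₁.plus h₂).su = t' ∩ (h₁.plus h₂).su →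
      (branchVar h₁ h₂ ∈ t ↔ branchVar h₁ h₂ ∈ t') := fun e => by
    simpa using sub e hy
  refine ⟨fun t t' e => ?_, fun t t' e => ?_, fun t t' e => ?_⟩
  · simp only [plus_amp, mem e, sub e (Finset.sdiff_subset.trans s₁),
      sub e (Finset.sdiff_subset.trans s₂), l₁.amp t t' (inter e s₁), l₂.amp t t' (inter e s₂)]
  · simp only [plus_qval _ _ _ _ hq, mem e, l₁.qval t t' (inter e s₁), l₂.qval t t' (inter e s₂)]
  · simp only [plus_history, mem e, l₁.history t t' (inter e s₁), l₂.history t t' (inter e s₂)]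

theorem sum_powerset_union {M : Type*} [AddCommMonoid M] (S₁ S₂ : Finset ℕ) (F : Finset ℕ → M)
    (hF : ∀ t, ¬ S₂ \ S₁ ⊆ t → F t = 0) :
    ∑ t ∈ (S₁ ∪ S₂).powerset, F t = ∑ t ∈ S₁.powerset, F (t ∪ (S₂ \ S₁)) := by
  symm
  refine Finset.sum_of_injOn (fun t => t ∪ (S₂ \ S₁)) ?_ ?_ ?_ (fun _ _ => rfl)
  · intro t ht t' ht' e
    simp only [Finset.coe_powerset, Set.mem_preimage, Set.mem_powerset_iff,
      Finset.coe_subset] at ht ht'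
    have h : ∀ {u : Finset ℕ}, u ⊆ S₁ → (u ∪ (S₂ \ S₁)) ∩ S₁ = u := by
      intro u hu; ext j
      have := @hu j
      simp only [Finset.mem_inter, Finset.mem_union, Finset.mem_sdiff]; tauto
    have := congrArg (· ∩ S₁) e
    simpa only [h ht, h ht'] using this
  · intro t ht
    simp only [Finset.coe_powerset, Set.mem_preimage, Set.mem_powerset_iff,
      Finset.coe_subset] at ht ⊢
    exact Finset.union_subset_union ht Finset.sdiff_subset
  · intro t ht hn
    refine hF t fun hs => hn ⟨t ∩ S₁, ?_, ?_⟩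
    · simp
    · ext j
      have h1 := @hs j
      have h2 := Finset.mem_powerset.1 ht
      replace h2 := @h2 j
      simp only [Finset.mem_inter, Finset.mem_union, Finset.mem_sdiff] at *; tauto

/-- A sum of path-sums has, up to paths of amplitude 0, the paths of its summands: the products of
path variables in the scalar fix the variables that the chosen summand does not use, so that each of
its paths is counted once. -/
theorem pathSum_plus (l₁ : h₁.Local x) (l₂ : h₂.Local x) (hq : h₁.alloc.q = h₂.alloc.q)
    {M : Type*} [AddCommMonoid M] (F : ℂ → History sg → QState sg → M)
    (hF : ∀ k q, F 0 k q = 0) :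
    (h₁.plus h₂).pathSum x F =
      h₁.pathSum x (fun α k q => F α (mergeHist h₂.cshape k) q) +
      h₂.pathSum x (fun α k q => F α (mergeHist h₁.cshape k) q) := by
  have hy : branchVar h₁ h₂ ∉ h₁.su ∪ h₂.su := fresh_notMem _
  have hy₁ : branchVar h₁ h₂ ∉ h₁.su := fun h => hy (Finset.mem_union_left _ h)
  have hy₂ : branchVar h₁ h₂ ∉ h₂.su := fun h => hy (Finset.mem_union_right _ h)
  simp only [pathSum]
  rw [plus_su, Finset.sum_powerset_insert hy, add_comm]
  congr 1
  · rw [sum_powerset_union]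
    · refine Finset.sum_congr rfl fun t ht => ?_
      rw [Finset.mem_powerset] at ht
      have e : insert (branchVar h₁ h₂) (t ∪ (h₂.su \ h₁.su)) ∩ h₁.su = t ∩ h₁.su := by
        ext j
        simp only [Finset.mem_inter, Finset.mem_insert, Finset.mem_union, Finset.mem_sdiff]
        constructor
        · rintro ⟨rfl | h | h, hj⟩
          · exact absurd hj hy₁
          · exact ⟨h, hj⟩
          · exact absurd hj h.2
        · rintro ⟨h, hj⟩
          exact ⟨Or.inr (Or.inl h), hj⟩
      rw [plus_amp, plus_history, plus_qval _ _ _ _ hq, if_pos (Finset.mem_insert_self _ _),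
        if_pos (Finset.mem_insert_self _ _), if_pos (Finset.mem_insert_self _ _),
        if_pos (Finset.subset_union_right.trans (Finset.subset_insert _ _)),
        l₁.amp _ _ e, l₁.qval _ _ e, l₁.history _ _ e]
    · intro t ht
      rw [plus_amp, if_pos (Finset.mem_insert_self _ _), if_neg, hF]
      intro h
      refine ht fun j hj => ?_
      rcases Finset.mem_insert.1 (h hj) with rfl | h'
      · exact absurd (Finset.sdiff_subset hj) hy₂
      · exact h'
  · have e0 : ∀ t ∈ (h₁.su ∪ h₂.su).powerset, branchVar h₁ h₂ ∉ t := fun t ht h =>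
      hy (Finset.mem_powerset.1 ht h)
    rw [Finset.sum_congr rfl (g := fun t => if h₁.su \ h₂.su ⊆ t then
      F (h₂.amp x t) (mergeHist h₁.cshape (h₂.history (val x t))) (h₂.qval (val x t)) else 0)]
    · rw [Finset.union_comm, sum_powerset_union]
      · refine Finset.sum_congr rfl fun t ht => ?_
        have e : (t ∪ (h₁.su \ h₂.su)) ∩ h₂.su = t ∩ h₂.su := by
          ext j
          simp only [Finset.mem_inter, Finset.mem_union, Finset.mem_sdiff]
          tauto
        rw [if_pos Finset.subset_union_right, l₂.amp _ _ e, l₂.qval _ _ e, l₂.history _ _ e]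
      · intro t ht
        rw [if_neg ht]
    · intro t ht
      rw [plus_amp, plus_history, plus_qval _ _ _ _ hq, if_neg (e0 t ht), if_neg (e0 t ht),
        if_neg (e0 t ht)]
      split_ifs
      · rfl
      · exact hF _ _

end plus

/-! ### Restrictions -/

theorem restrict_amp (b : BExp) (h : HPS sg) (x : ℕ → Bool) (t : Finset ℕ) :
    (h.restrict b).amp x t = if b.eval (val x t) then h.amp x t else 0 := by
  simp only [amp, restrict, scale, Scalar.eval, Scalar.eval_lift]
  split_ifs <;> simp

/-- Along each path, `b` is a function of the history and the basis state, so that restriction to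
`b` keeps the amplitude and the memory local. -/
theorem Local.restrict {h : HPS sg} {x : ℕ → Bool} (l : h.Local x) {b : BExp}
    (f : History sg → QState sg → Bool)
    (hb : ∀ t, b.eval (val x t) = f (h.history (val x t)) (h.qval (val x t))) :
    (h.restrict b).Local x where
  amp t t' e := by
    rw [restrict_amp, restrict_amp, hb, hb, l.amp t t' e, l.qval t t' e, l.history t t' e]
  qval := l.qval
  history := l.history

theorem pathSum_restrict {h : HPS sg} {x : ℕ → Bool} {b : BExp}
    (f : History sg → QState sg → Bool)
    (hb : ∀ t, b.eval (val x t) = f (h.history (val x t)) (h.qval (val x t)))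
    {M : Type*} [AddCommMonoid M] (F : ℂ → History sg → QState sg → M) :
    (h.restrict b).pathSum x F = h.pathSum x fun α k q => F (if f k q then α else 0) k q := by
  refine Finset.sum_congr rfl fun t _ => ?_
  rw [restrict_amp, hb]
  rfl

end HPS

/-! ### Gates on hybrid path-sums -/

namespace HPS
variable {sg : Sig}

theorem mem_alloc_q {h : HPS sg} {a : QCell sg} : a ∈ h.alloc.q ↔ (h.o.q a).isSome = true := by
  simp [alloc]

section gate
variable (h : HPS sg) (x : ℕ → Bool) (a : QCell sg)

theorem setQ_qval (b : BExp) (v : SVar → Bool) :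
    (h.setQ a b).qval v = Function.update (h.qval v) a (some (b.eval v)) := by
  funext a'
  by_cases e : a' = a
  · subst e; simp [qval, setQ]
  · simp [qval, setQ, e]

theorem setQ_alloc (b : BExp) : (h.setQ a b).alloc = ⟨insert a h.alloc.q, h.alloc.c⟩ := by
  have : (h.setQ a b).alloc.q = insert a h.alloc.q := by
    ext a'
    rw [Finset.mem_insert, mem_alloc_q, mem_alloc_q]
    by_cases e : a' = a
    · subst e; simp [setQ]
    · simp [setQ, e]
  rw [← this]; rfl

theorem gate_H_amp (t : Finset ℕ) : (h.gate .H a).amp x t =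
    Gate.mat .H (decide (fresh h.su ∈ t)) ((h.qval (val x t) a).getD false) * h.amp x t := by
  have hs : (h.gate .H a).s.eval (val x t) = (Real.sqrt 2)⁻¹ * h.s.eval (val x t) := by
    simp [gate, setQ, addPhase, addPath, scale, Scalar.eval]
  have hp : (h.gate .H a).p.eval (val x t) = h.p.eval (val x t) +
      (if (decide (fresh h.su ∈ t) && (h.qval (val x t) a).getD false) = true then 1 else 0) / 2 := by
    rw [← eval_curQ]
    change _ + _ = _
    simp only [Phase.eval, pow_one]
    rfl
  rw [amp, amp, hs, hp, Gate.mat, Matrix.of_apply]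
  push_cast
  rw [mul_add, Complex.exp_add]
  split_ifs with hc
  -- The phase `1 / 2` contributes the sign `e^{πi} = -1`.
  · rw [Complex.ofReal_one, show 2 * (Real.pi : ℂ) * Complex.I * (1 / 2) = Real.pi * Complex.I by ring,
      Complex.exp_pi_mul_I]
    ring
  · simp; ring

theorem gate_Z_amp (k : ℕ) (t : Finset ℕ) : (h.gate (.Z k) a).amp x t =
    (if (h.qval (val x t) a).getD false then
      Complex.exp (2 * Real.pi * Complex.I * ((1 / 2 ^ k : ℝ) : ℂ)) else 1) * h.amp x t := by
  have hp : (h.gate (.Z k) a).p.eval (val x t) = h.p.eval (val x t) +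
      (if (h.qval (val x t) a).getD false = true then 1 else 0) / 2 ^ k := by
    rw [← eval_curQ]
    rfl
  rw [amp, amp, hp, Complex.ofReal_add, mul_add, Complex.exp_add]
  change (h.s.eval (val x t) : ℂ) * _ = _
  split_ifs with hc
  · ring
  · simp

variable {h x}

theorem Local.gate (l : h.Local x) (G : Gate) : (h.gate G a).Local x := by
  cases G with
  | H =>
    have sub : ∀ {t t' : Finset ℕ}, t ∩ (h.gate .H a).su = t' ∩ (h.gate .H a).su →
        t ∩ h.su = t' ∩ h.su := by
      intro t t' e
      have hs : (h.gate .H a).su ∩ h.su = h.su :=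
        Finset.inter_eq_right.2 (Finset.subset_insert _ _)
      rw [← hs, ← Finset.inter_assoc, e, Finset.inter_assoc]
    have mem : ∀ {t t' : Finset ℕ}, t ∩ (h.gate .H a).su = t' ∩ (h.gate .H a).su →
        decide (fresh h.su ∈ t) = decide (fresh h.su ∈ t') := by
      intro t t' e
      have := congrArg (fresh h.su ∈ ·) e
      have hm : fresh h.su ∈ (h.gate .H a).su := Finset.mem_insert_self _ _
      simpa [hm] using this
    refine ⟨fun t t' e => ?_, fun t t' e => ?_, fun t t' e => l.history t t' (sub e)⟩
    · rw [gate_H_amp, gate_H_amp, mem e, l.qval t t' (sub e), l.amp t t' (sub e)]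
    · have := mem e
      change (HPS.setQ _ a _).qval _ = (HPS.setQ _ a _).qval _
      rw [setQ_qval, setQ_qval]
      change Function.update (h.qval _) a (some (decide _)) =
        Function.update (h.qval _) a (some (decide _))
      rw [this, l.qval t t' (sub e)]
  | X =>
    refine ⟨l.amp, fun t t' e => ?_, l.history⟩
    change (h.setQ a _).qval _ = (h.setQ a _).qval _
    simp only [setQ_qval, BExp.eval, eval_curQ, l.qval t t' e]
  | Z k =>
    refine ⟨fun t t' e => ?_, l.qval, l.history⟩
    rw [gate_Z_amp, gate_Z_amp, l.qval t t' e, l.amp t t' e]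

theorem gate_amp_eq_zero (G : Gate) {t : Finset ℕ} (ht : h.amp x t = 0) :
    (h.gate G a).amp x t = 0 := by
  cases G with
  | H => rw [gate_H_amp, ht, mul_zero]
  | X => exact ht
  | Z k => rw [gate_Z_amp, ht, mul_zero]

theorem gate_history (G : Gate) (v : SVar → Bool) :
    (h.gate G a).history v = h.history v := by
  cases G <;> rfl

theorem gate_cshape (G : Gate) : (h.gate G a).cshape = h.cshape := by
  cases G <;> rfl

variable {a}

theorem gate_alloc (G : Gate) (ha : a ∈ h.alloc.q) : (h.gate G a).alloc = h.alloc := by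
  cases G with
  | H => exact (setQ_alloc _ a _).trans (by
      change (⟨insert a h.alloc.q, h.alloc.c⟩ : Alloc sg) = h.alloc
      rw [Finset.insert_eq_self.2 ha])
  | X => exact (setQ_alloc _ a _).trans (by rw [Finset.insert_eq_self.2 ha])
  | Z k => rfl

/-- A gate replaces each path by one path for each new value of its qubit. -/
theorem pathSum_gate (l : h.Local x) (G : Gate) (ha : a ∈ h.alloc.q)
    {M : Type*} [AddCommMonoid M] (F : ℂ → History sg → QState sg → M)
    (hF : ∀ k q, F 0 k q = 0) :
    (h.gate G a).pathSum x F = h.pathSum x fun α k q =>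
      ∑ d, F (G.mat d ((q a).getD false) * α) k (Function.update q a (some d)) := by
  cases G with
  | H =>
    have hy := fresh_notMem h.su
    have hqv : ∀ t, (h.gate .H a).qval (val x t) =
        Function.update (h.qval (val x t)) a (some (decide (fresh h.su ∈ t))) := fun t =>
      setQ_qval _ a _ _
    simp only [pathSum]
    rw [show (h.gate .H a).su = insert (fresh h.su) h.su from rfl, Finset.sum_powerset_insert hy,
      ← Finset.sum_add_distrib]
    refine Finset.sum_congr rfl fun t ht => ?_
    have h1 : fresh h.su ∉ t := fun e => hy (Finset.mem_powerset.1 ht e)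
    have e : insert (fresh h.su) t ∩ h.su = t ∩ h.su := Finset.insert_inter_of_notMem hy
    rw [Fintype.sum_bool, add_comm]
    congr 1
    · rw [gate_H_amp, hqv, gate_history, l.amp _ _ e, l.qval _ _ e, l.history _ _ e]
      simp
    · rw [gate_H_amp, hqv, gate_history]
      simp [h1]
  | X =>
    refine Finset.sum_congr rfl fun t _ => ?_
    beta_reduce
    have hqv : (h.gate .X a).qval (val x t) =
        Function.update (h.qval (val x t)) a (some (!(h.qval (val x t) a).getD false)) := by
      rw [← eval_curQ]
      refine (setQ_qval _ a _ _).trans ?_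
      simp [BExp.eval]
    have ham : (h.gate .X a).amp x t = h.amp x t := rfl
    rw [hqv, ham, gate_history, Fintype.sum_bool]
    cases (h.qval (val x t) a).getD false <;> simp [Gate.mat, hF]
  | Z k =>
    refine Finset.sum_congr rfl fun t _ => ?_
    beta_reduce
    have hqv : (h.gate (.Z k) a).qval (val x t) = h.qval (val x t) := rfl
    -- Only the old value of the qubit has a nonzero coefficient, and the qubit is not a hole.
    have hup : Function.update (h.qval (val x t)) a (some ((h.qval (val x t) a).getD false)) =
        h.qval (val x t) := by
      rw [← dom_qval h (val x t), QState.mem_dom] at ha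
      obtain ⟨b, hb⟩ := Option.isSome_iff_exists.1 ha
      rw [hb, Option.getD_some, ← hb, Function.update_eq_self]
    rw [hqv, gate_Z_amp, gate_history, Finset.sum_eq_single ((h.qval (val x t) a).getD false), hup]
    · simp [Gate.mat]
    · intro d _ hd
      rw [Gate.mat, Matrix.diagonal_apply_ne _ hd, zero_mul, hF]
    · simp

end gate

/-! ### Unitary evolution -/

/-- `h'` arises from `h` by applying, for each history, the operator `U` of the present classical
bits to the qubits `Q`; the histories along the paths stay the same. -/
structure QStep (x : ℕ → Bool) (Q : Finset (QCell sg))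
    (U : (CCell sg → Bool) → Matrix (Q → Bool) (Q → Bool) ℂ) (h h' : HPS sg) : Prop where
  isLocal : h'.Local x
  alloc : h'.alloc = h.alloc
  cshape : h'.cshape = h.cshape
  history : ∀ t, h'.history (val x t) = h.history (val x t)
  amp : ∀ t, h.amp x t = 0 → h'.amp x t = 0
  psi : ∀ η, h'.psi x η = (liftOp Q (U η.present.bits)).mulVec (h.psi x η)

theorem subset_dom_of_psi_ne_zero {h : HPS sg} {x : ℕ → Bool} {Q : Finset (QCell sg)}
    (hQ : Q ⊆ h.alloc.q) {η : History sg} (m : QState sg) (hm : h.psi x η m ≠ 0) : Q ⊆ m.dom := by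
  rwa [psi_apply_ne_zero hm]

theorem QStep.refl {h : HPS sg} {x : ℕ → Bool} {Q : Finset (QCell sg)} (l : h.Local x)
    (hQ : Q ⊆ h.alloc.q) : QStep x Q (fun _ => 1) h h :=
  ⟨l, rfl, rfl, fun _ => rfl, fun _ => id,
    fun _ => (liftOp_one_mulVec (subset_dom_of_psi_ne_zero hQ)).symm⟩

theorem QStep.trans {x : ℕ → Bool} {Q : Finset (QCell sg)}
    {U V : (CCell sg → Bool) → Matrix (Q → Bool) (Q → Bool) ℂ} {h h' h'' : HPS sg}
    (s : QStep x Q U h h') (s' : QStep x Q V h' h'') :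
    QStep x Q (fun v => V v * U v) h h'' :=
  ⟨s'.isLocal, s'.alloc.trans s.alloc, s'.cshape.trans s.cshape,
    fun t => (s'.history t).trans (s.history t), fun t ht => s'.amp t (s.amp t ht),
    fun η => by rw [s'.psi, s.psi, Matrix.mulVec_mulVec, liftOp_mul]⟩

theorem QStep.foldl {x : ℕ → Bool} {Q : Finset (QCell sg)} {ι : Type*} (f : HPS sg → ι → HPS sg)
    (U : (CCell sg → Bool) → ι → Matrix (Q → Bool) (Q → Bool) ℂ) (l : List ι)
    (hf : ∀ k ∈ l, ∀ h : HPS sg, h.Local x → Q ⊆ h.alloc.q → QStep x Q (fun v => U v k) h (f h k))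
    {h h' : HPS sg} {V : (CCell sg → Bool) → Matrix (Q → Bool) (Q → Bool) ℂ}
    (hQ : Q ⊆ h.alloc.q) (s : QStep x Q V h h') :
    QStep x Q (fun v => l.foldl (fun M k => U v k * M) (V v)) h (l.foldl f h') := by
  induction l generalizing h' V with
  | nil => exact s
  | cons k l ih =>
    refine ih (fun k' hk' => hf k' (List.mem_cons_of_mem _ hk'))
      (s.trans (hf k List.mem_cons_self h' s.isLocal ?_))
    rw [s.alloc]; exact hQ

theorem QStep.gate {h : HPS sg} {x : ℕ → Bool} {Q : Finset (QCell sg)} (l : h.Local x)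
    (hQ : Q ⊆ h.alloc.q) (G : Gate) (a : Q) :
    QStep x Q (fun _ => gateOn a G.mat) h (h.gate G a) := by
  refine ⟨l.gate a.1 G, gate_alloc G (hQ a.2), gate_cshape a.1 G, fun t => gate_history a.1 G _,
    fun t => gate_amp_eq_zero a.1 G, fun η => ?_⟩
  rw [psi_eq_pathSum, pathSum_gate l G (hQ a.2) _ (by intros; split_ifs <;> simp), HPS.psi,
    Matrix.mulVec_sum]
  refine Finset.sum_congr rfl fun t _ => ?_
  beta_reduce
  by_cases hη : h.history (val x t) = η
  · simp only [if_pos hη]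
    have e : (Pi.single (h.qval (val x t)) (h.amp x t) : QState sg → ℂ) =
        h.amp x t • Pi.single (h.qval (val x t)) 1 := by
      rw [← Pi.single_smul, smul_eq_mul, mul_one]
    rw [e, Matrix.mulVec_smul, liftOp_gateOn_mulVec_single a, Finset.smul_sum]
    · refine Finset.sum_congr rfl fun d _ => ?_
      rw [← Pi.single_smul, smul_eq_mul, mul_comm]
    · rw [dom_qval]; exact hQ
  · simp only [if_neg hη, Matrix.mulVec_zero, Finset.sum_const_zero]

theorem psi_restrict {h : HPS sg} {x : ℕ → Bool} {b : BExp} (f : History sg → QState sg → Bool)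
    (hb : ∀ t, b.eval (val x t) = f (h.history (val x t)) (h.qval (val x t)))
    (η : History sg) (m : QState sg) :
    (h.restrict b).psi x η m = if f η m then h.psi x η m else 0 := by
  have key : ∀ t, (if h.history (val x t) = η then Pi.single (h.qval (val x t))
      (if f (h.history (val x t)) (h.qval (val x t)) then h.amp x t else 0) else 0 :
        QState sg → ℂ) m =
      (if f η m then 1 else 0) * (if h.history (val x t) = η then
        Pi.single (h.qval (val x t)) (h.amp x t) else 0 : QState sg → ℂ) m := by
    intro t
    by_cases hη : h.history (val x t) = η
    · simp only [if_pos hη, Pi.single_apply]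
      by_cases hm : m = h.qval (val x t)
      · simp [hm, hη]
      · simp [hm]
    · simp only [if_neg hη, Pi.zero_apply, mul_zero]
  rw [psi_eq_pathSum, pathSum_restrict f hb, HPS.psi, pathSum, Finset.sum_apply, Finset.sum_apply,
    Finset.sum_congr rfl fun t _ => key t, ← Finset.mul_sum, ite_mul, one_mul, zero_mul]

end HPS

/-! ### The operators of unitary programs -/

/-- The bits `i` of the qubits `Q`, extended to all qubits by 0. -/
def extendBits {sg : Sig} (Q : Finset (QCell sg)) (i : Q → Bool) : QCell sg → Bool :=
  fun a => if ha : a ∈ Q then i ⟨a, ha⟩ else false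

/-- The projector on the basis states where the Boolean `b` has value `d`. -/
noncomputable def QBool.proj {sg : Sig} (Q : Finset (QCell sg)) (v : CCell sg → Bool) (ρ : Env)
    (b : QBool sg) (d : Bool) : Matrix (Q → Bool) (Q → Bool) ℂ :=
  Matrix.diagonal fun i => if b.value ρ (extendBits Q i) v = d then 1 else 0

/-- The operator of a unitary program on the qubits `Q`, when the classical memory is `v`. Gates on
qubits outside `Q` are ignored. -/
noncomputable def QProg.op {sg : Sig} (Q : Finset (QCell sg)) (v : CCell sg → Bool) :
    Env → QProg sg → Matrix (Q → Bool) (Q → Bool) ℂ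
  | _, .skip => 1
  | ρ, .seq p q => q.op Q v ρ * p.op Q v ρ
  | ρ, .loop x i j p =>
      (loopRange (i.eval ρ) (j.eval ρ)).foldl (fun M k => p.op Q v (Function.update ρ x k) * M) 1
  | ρ, .ite b p q => p.op Q v ρ * b.proj Q v ρ true + q.op Q v ρ * b.proj Q v ρ false
  | ρ, .apply G R => (R.cells ρ).foldl
      (fun M a => (if ha : a ∈ Q then gateOn ⟨a, ha⟩ G.mat else 1) * M) 1

namespace HPS
variable {sg : Sig}

theorem psi_restrict_sym {h : HPS sg} {x : ℕ → Bool} {Q : Finset (QCell sg)}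
    (hQ : Q ⊆ h.alloc.q) {ρ : Env} {b : QBool sg} (hb : b.qcells ρ ⊆ Q) {e : BExp} {d : Bool}
    (he : ∀ t, e.eval (val x t) = decide (b.value ρ (fun a => (h.qval (val x t) a).getD false)
      (h.history (val x t)).present.bits = d)) (η : History sg) :
    (h.restrict e).psi x η =
      (liftOp Q (b.proj Q η.present.bits ρ d)).mulVec (h.psi x η) := by
  funext m
  rw [psi_restrict (fun η m => decide (b.value ρ (fun a => (m a).getD false)
      η.present.bits = d)) he, QBool.proj, liftOp_diagonal, Matrix.mulVec_diagonal]
  by_cases hm : h.psi x η m = 0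
  · simp [hm]
  · rw [if_pos (subset_dom_of_psi_ne_zero hQ m hm), b.value_congr ρ η.present.bits
      (w := extendBits Q (m.bits Q)) (w' := fun a => (m a).getD false)]
    · by_cases hd : b.value ρ (fun a => (m a).getD false) η.present.bits = d <;> simp [hd]
    · intro a ha
      simp [extendBits, QState.bits, hb ha]

/-- When both summands have stacks of the same shape, histories are unchanged and vectors add. -/
theorem psi_plus {h₁ h₂ : HPS sg} {x : ℕ → Bool} (l₁ : h₁.Local x) (l₂ : h₂.Local x)
    (hq : h₁.alloc.q = h₂.alloc.q) (hc : h₁.cshape = h₂.cshape) (η : History sg) :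
    (h₁.plus h₂).psi x η = h₁.psi x η + h₂.psi x η := by
  rw [psi_eq_pathSum, pathSum_plus l₁ l₂ hq _ (by intros; split_ifs <;> simp)]
  congr 1
  · refine Finset.sum_congr rfl fun t _ => ?_
    beta_reduce
    rw [← hc, ← map_rowShape_history h₁ (val x t), mergeHist_self]
  · refine Finset.sum_congr rfl fun t _ => ?_
    beta_reduce
    rw [hc, ← map_rowShape_history h₂ (val x t), mergeHist_self]

end HPS

open HPS in
/-- Symbolic execution of a unitary program applies its operator. -/
theorem QProg.run_step {sg : Sig} {x : ℕ → Bool} {Q : Finset (QCell sg)} {C : Finset (CCell sg)} :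
    ∀ (p : QProg sg) (ρ : Env) (h : HPS sg), p.WellFormed ⟨Q, C⟩ ρ → h.Local x → Q ⊆ h.alloc.q →
      QStep x Q (fun v => p.op Q v ρ) h (p.run ρ h)
  | .skip, ρ, h, _, l, hQ => by
      simp only [op, run]
      exact QStep.refl l hQ
  | .seq p q, ρ, h, hw, l, hQ => by
      have s := run_step p ρ h hw.1 l hQ
      simp only [op, run]
      exact s.trans (run_step q ρ _ hw.2 s.isLocal (by rw [s.alloc]; exact hQ))
  | .loop y i j p, ρ, h, hw, l, hQ => by
      simp only [op, run]
      exact QStep.foldl _ (fun v k => p.op Q v (Function.update ρ y k)) _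
        (fun k hk h' l' hQ' => run_step p _ h' (hw k hk) l' hQ') hQ (QStep.refl l hQ)
  | .ite b p q, ρ, h, hw, l, hQ => by
      obtain ⟨hbq, -, -, -, hp, hq⟩ := hw
      have e₁ : ∀ t, (b.sym ρ h).eval (val x t) =
          decide (b.value ρ (fun a => (h.qval (val x t) a).getD false)
            (h.history (val x t)).present.bits = true) := fun t => by
        rw [b.eval_sym]; simp
      have e₂ : ∀ t, (BExp.xor BExp.one (b.sym ρ h)).eval (val x t) =
          decide (b.value ρ (fun a => (h.qval (val x t) a).getD false)
            (h.history (val x t)).present.bits = false) := fun t => by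
        rw [BExp.eval, b.eval_sym]; simp [BExp.eval]
      have s₁ := run_step p ρ (h.restrict (b.sym ρ h)) hp
        (l.restrict (fun η m => decide (b.value ρ (fun a => (m a).getD false)
          η.present.bits = true)) e₁) hQ
      have s₂ := run_step q ρ (h.restrict (BExp.xor BExp.one (b.sym ρ h))) hq
        (l.restrict (fun η m => decide (b.value ρ (fun a => (m a).getD false)
          η.present.bits = false)) e₂) hQ
      have ha : (p.run ρ (h.restrict (b.sym ρ h))).alloc =
          (q.run ρ (h.restrict (BExp.xor BExp.one (b.sym ρ h)))).alloc :=
        s₁.alloc.trans s₂.alloc.symm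
      have hc : (p.run ρ (h.restrict (b.sym ρ h))).cshape =
          (q.run ρ (h.restrict (BExp.xor BExp.one (b.sym ρ h)))).cshape :=
        s₁.cshape.trans s₂.cshape.symm
      simp only [run]
      have hh : ∀ t, ((p.run ρ (h.restrict (b.sym ρ h))).plus
          (q.run ρ (h.restrict (BExp.xor BExp.one (b.sym ρ h))))).history (val x t) =
          h.history (val x t) := fun t => by
        rw [plus_history, s₁.cshape, s₂.cshape, s₁.history, s₂.history]
        change (if _ then mergeHist h.cshape (h.history (val x t)) else
          mergeHist h.cshape (h.history (val x t))) = _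
        rw [ite_self, ← map_rowShape_history h (val x t), mergeHist_self]
      refine ⟨s₁.isLocal.plus s₂.isLocal (congrArg Alloc.q ha), (plus_alloc _ _ ha).trans s₁.alloc,
        ?_, hh, fun t ht => ?_, fun η => ?_⟩
      · rw [← map_rowShape_history _ (val x ∅), hh, map_rowShape_history]
      · rw [plus_amp, s₁.amp t (by rw [restrict_amp, ht, ite_self]),
          s₂.amp t (by rw [restrict_amp, ht, ite_self])]
        simp
      · rw [psi_plus s₁.isLocal s₂.isLocal (congrArg Alloc.q ha) hc, s₁.psi, s₂.psi,
          psi_restrict_sym hQ hbq e₁, psi_restrict_sym hQ hbq e₂, Matrix.mulVec_mulVec,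
          Matrix.mulVec_mulVec, liftOp_mul, liftOp_mul, ← Matrix.add_mulVec, ← liftOp_add]
        rfl
  | .apply G R, ρ, h, hw, l, hQ => by
      simp only [op, run]
      refine QStep.foldl (fun h a => h.gate G a)
        (fun _ a => if ha : a ∈ Q then gateOn ⟨a, ha⟩ G.mat else 1) _
        (fun a ha h' l' hQ' => ?_) hQ (QStep.refl l hQ)
      have haQ : a ∈ Q := hw (List.mem_toFinset.2 ha)
      simp only [haQ, dif_pos]
      exact QStep.gate l' hQ' G ⟨a, haQ⟩

/-! ### Unitarity -/

/-- The operator `M` on the qubits `Q` leaves the qubits outside `T` alone. -/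
def PreservesOff {sg : Sig} {Q : Finset (QCell sg)} (T : Finset (QCell sg))
    (M : Matrix (Q → Bool) (Q → Bool) ℂ) : Prop :=
  ∀ i j, M i j ≠ 0 → ∀ a : Q, a.1 ∉ T → i a = j a

section PreservesOff
variable {sg : Sig} {Q T : Finset (QCell sg)} {M N : Matrix (Q → Bool) (Q → Bool) ℂ}

theorem PreservesOff.mono {T' : Finset (QCell sg)} (hM : PreservesOff T M) (h : T ⊆ T') :
    PreservesOff T' M := fun i j hij a ha => hM i j hij a fun h' => ha (h h')

theorem PreservesOff.diagonal (d : (Q → Bool) → ℂ) : PreservesOff T (Matrix.diagonal d) :=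
  fun i j hij a _ => by
    by_cases e : i = j
    · rw [e]
    · exact absurd (Matrix.diagonal_apply_ne _ e) hij

theorem PreservesOff.one : PreservesOff T (1 : Matrix (Q → Bool) (Q → Bool) ℂ) := by
  rw [← Matrix.diagonal_one]; exact PreservesOff.diagonal _

theorem PreservesOff.mul (hM : PreservesOff T M) (hN : PreservesOff T N) :
    PreservesOff T (M * N) := fun i k hik a ha => by
  rw [Matrix.mul_apply] at hik
  obtain ⟨j, _, hj⟩ := Finset.exists_ne_zero_of_sum_ne_zero hik
  exact (hM i j (left_ne_zero_of_mul hj) a ha).trans (hN j k (right_ne_zero_of_mul hj) a ha)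

theorem PreservesOff.add (hM : PreservesOff T M) (hN : PreservesOff T N) :
    PreservesOff T (M + N) := fun i j hij a ha => by
  by_cases h : M i j = 0
  · refine hN i j (fun h' => hij ?_) a ha
    rw [Matrix.add_apply, h, h', add_zero]
  · exact hM i j h a ha

theorem PreservesOff.foldl {ι : Type*} (U : ι → Matrix (Q → Bool) (Q → Bool) ℂ) (l : List ι)
    (hU : ∀ k ∈ l, PreservesOff T (U k)) (hM : PreservesOff T M) :
    PreservesOff T (l.foldl (fun M k => U k * M) M) := by
  induction l generalizing M with
  | nil => exact hM
  | cons k l ih =>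
    exact ih (fun k' hk' => hU k' (List.mem_cons_of_mem _ hk'))
      ((hU k List.mem_cons_self).mul hM)

theorem QProg.preservesOff_op (v : CCell sg → Bool) : ∀ (p : QProg sg) (ρ : Env),
    PreservesOff (p.targets ρ) (p.op Q v ρ)
  | .skip, ρ => by
      simp only [op]
      exact PreservesOff.one
  | .seq p q, ρ => by
      simp only [op, targets]
      exact ((preservesOff_op v q ρ).mono Finset.subset_union_right).mul
        ((preservesOff_op v p ρ).mono Finset.subset_union_left)
  | .loop y i j p, ρ => by
      simp only [op, targets]
      refine PreservesOff.foldl _ _ (fun k hk => ?_) PreservesOff.one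
      exact (preservesOff_op v p _).mono
        (Finset.subset_biUnion_of_mem (fun k => p.targets (Function.update ρ y k))
          (List.mem_toFinset.2 hk))
  | .ite b p q, ρ => by
      simp only [op, targets]
      exact (((preservesOff_op v p ρ).mono Finset.subset_union_left).mul
        (PreservesOff.diagonal _)).add
        (((preservesOff_op v q ρ).mono Finset.subset_union_right).mul (PreservesOff.diagonal _))
  | .apply G R, ρ => by
      simp only [op, targets]
      refine PreservesOff.foldl (fun a => if ha : a ∈ Q then gateOn ⟨a, ha⟩ G.mat else 1) _
        (fun a ha => ?_) PreservesOff.one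
      split_ifs with haQ
      · intro i j hij b hb
        by_contra hne
        refine hij (if_neg fun hall => hne (hall b fun e => hb ?_))
        rw [e]; exact List.mem_toFinset.2 ha
      · exact PreservesOff.one

/-- An operator commutes with the projectors of a control that is disjoint from its targets. -/
theorem PreservesOff.comm_proj (hM : PreservesOff T M) {ρ : Env} {b : QBool sg}
    (hb : Disjoint (b.qcells ρ) T) (v : CCell sg → Bool) (d : Bool) :
    M * b.proj Q v ρ d = b.proj Q v ρ d * M := by
  ext i j
  rw [QBool.proj, Matrix.mul_diagonal, Matrix.diagonal_mul, mul_comm]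
  by_cases h : M i j = 0
  · simp [h]
  · rw [b.value_congr ρ v (w := extendBits Q i) (w' := extendBits Q j)]
    intro a ha
    simp only [extendBits]
    split_ifs with haQ
    · exact hM i j h ⟨a, haQ⟩ (Finset.disjoint_left.1 hb ha)
    · rfl

end PreservesOff

theorem foldl_mul_mem {R ι : Type*} [Monoid R] (S : Submonoid R) (U : ι → R) (l : List ι)
    (hU : ∀ k ∈ l, U k ∈ S) {M : R} (hM : M ∈ S) : l.foldl (fun M k => U k * M) M ∈ S := by
  induction l generalizing M with
  | nil => exact hM
  | cons k l ih =>
    exact ih (fun k' hk' => hU k' (List.mem_cons_of_mem _ hk'))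
      (S.mul_mem (hU k List.mem_cons_self) hM)

namespace QBool
variable {sg : Sig} (Q : Finset (QCell sg)) (v : CCell sg → Bool) (ρ : Env) (b : QBool sg)

theorem conjTranspose_proj (d : Bool) : (b.proj Q v ρ d).conjTranspose = b.proj Q v ρ d := by
  rw [proj, Matrix.diagonal_conjTranspose]
  congr 1; funext i
  simp only [Pi.star_apply]
  split_ifs <;> simp

theorem proj_mul_proj (d d' : Bool) :
    b.proj Q v ρ d * b.proj Q v ρ d' = if d = d' then b.proj Q v ρ d else 0 := by
  rw [proj, proj, Matrix.diagonal_mul_diagonal]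
  split_ifs with h
  · subst h; congr 1; funext i; split_ifs <;> simp
  · rw [← Matrix.diagonal_zero]
    congr 1; funext i
    cases d <;> cases d' <;> simp_all

theorem proj_add_proj : b.proj Q v ρ true + b.proj Q v ρ false = 1 := by
  rw [proj, proj, Matrix.diagonal_add, ← Matrix.diagonal_one]
  congr 1; funext i
  cases b.value ρ (extendBits Q i) v <;> simp

end QBool

/-- Two unitaries controlled by complementary projectors with which they commute form a unitary. -/
theorem controlled_mul_star_self {R : Type*} [Ring R] [StarRing R] {U V P P' : R}
    (hU : U * star U = 1) (hV : V * star V = 1) (hUP : U * P = P * U) (hVP : V * P' = P' * V)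
    (hP : star P = P) (hP' : star P' = P') (m : P * P = P) (m' : P' * P' = P')
    (o : P * P' = 0) (o' : P' * P = 0) (a : P + P' = 1) :
    (U * P + V * P') * star (U * P + V * P') = 1 := by
  have k1 : U * P * (P * star U) = P := by
    rw [mul_assoc, ← mul_assoc P, m, ← mul_assoc, hUP, mul_assoc, hU, mul_one]
  have k2 : V * P' * (P' * star V) = P' := by
    rw [mul_assoc, ← mul_assoc P', m', ← mul_assoc, hVP, mul_assoc, hV, mul_one]
  have k3 : U * P * (P' * star V) = 0 := by
    rw [mul_assoc, ← mul_assoc P, o, zero_mul, mul_zero]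
  have k4 : V * P' * (P * star U) = 0 := by
    rw [mul_assoc, ← mul_assoc P', o', zero_mul, mul_zero]
  rw [star_add, star_mul, star_mul, hP, hP', add_mul, mul_add, mul_add, k1, k2, k3, k4, add_zero,
    zero_add, a]

/-- The disjointness of controls and targets makes conditionals unitary. -/
theorem QProg.op_mem_unitaryGroup {sg : Sig} {Q : Finset (QCell sg)} {A : Alloc sg}
    (v : CCell sg → Bool) : ∀ (p : QProg sg) (ρ : Env), p.WellFormed A ρ →
      p.op Q v ρ ∈ Matrix.unitaryGroup (Q → Bool) ℂ
  | .skip, ρ, _ => by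
      simp only [op]
      exact one_mem _
  | .seq p q, ρ, hw => by
      simp only [op]
      exact mul_mem (op_mem_unitaryGroup v q ρ hw.2) (op_mem_unitaryGroup v p ρ hw.1)
  | .loop y i j p, ρ, hw => by
      simp only [op]
      exact foldl_mul_mem _ _ _ (fun k hk => op_mem_unitaryGroup v p _ (hw k hk)) (one_mem _)
  | .ite b p q, ρ, hw => by
      obtain ⟨-, -, dp, dq, hp, hq⟩ := hw
      have up := Matrix.mem_unitaryGroup_iff.1 (op_mem_unitaryGroup (Q := Q) v p ρ hp)
      have uq := Matrix.mem_unitaryGroup_iff.1 (op_mem_unitaryGroup (Q := Q) v q ρ hq)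
      have cp := fun d => (preservesOff_op (Q := Q) v p ρ).comm_proj dp v d
      have cq := fun d => (preservesOff_op (Q := Q) v q ρ).comm_proj dq v d
      simp only [op]
      exact Matrix.mem_unitaryGroup_iff.2 (controlled_mul_star_self up uq (cp _) (cq _)
        (b.conjTranspose_proj Q v ρ true) (b.conjTranspose_proj Q v ρ false)
        (by simp [b.proj_mul_proj]) (by simp [b.proj_mul_proj]) (by simp [b.proj_mul_proj])
        (by simp [b.proj_mul_proj]) (b.proj_add_proj Q v ρ))
  | .apply G R, ρ, _ => by
      simp only [op]
      refine foldl_mul_mem (Matrix.unitaryGroup (Q → Bool) ℂ)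
        (fun a => if ha : a ∈ Q then gateOn ⟨a, ha⟩ G.mat else 1) (R.cells ρ)
        (fun a _ => ?_) (Submonoid.one_mem _)
      split_ifs
      · exact gateOn_mem_unitaryGroup _ G.mat_mem_unitaryGroup
      · exact one_mem _


/-! ### Translation to qhl-cv -/

/-- The qubits that a unitary program uses, as controls or as targets. -/
def QProg.qubits {sg : Sig} : Env → QProg sg → Finset (QCell sg)
  | _, .skip => ∅
  | ρ, .seq p q => p.qubits ρ ∪ q.qubits ρ
  | ρ, .loop x i j p =>
      (loopRange (i.eval ρ) (j.eval ρ)).toFinset.biUnion fun k =>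
        p.qubits (Function.update ρ x k)
  | ρ, .ite b p q => b.qcells ρ ∪ (p.qubits ρ ∪ q.qubits ρ)
  | ρ, .apply _ Q => (Q.cells ρ).toFinset

theorem QProg.WellFormed.qubits_subset {sg : Sig} {A : Alloc sg} : ∀ {p : QProg sg} {ρ : Env},
    p.WellFormed A ρ → p.qubits ρ ⊆ A.q
  | .skip, _, _ => Finset.empty_subset _
  | .seq p q, ρ, hw => by
      rw [qubits]
      exact Finset.union_subset (qubits_subset (p := p) hw.1) (qubits_subset (p := q) hw.2)
  | .loop y i j p, ρ, hw => by
      rw [qubits]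
      exact Finset.biUnion_subset.2 fun k hk =>
        qubits_subset (p := p) (hw k (List.mem_toFinset.1 hk))
  | .ite b p q, ρ, hw => by
      rw [qubits]
      exact Finset.union_subset hw.1 (Finset.union_subset (qubits_subset (p := p) hw.2.2.2.2.1)
        (qubits_subset (p := q) hw.2.2.2.2.2))
  | .apply G R, ρ, hw => hw

/-- Well-formedness concerns only the qubits in use, so that the operator of a program can be taken on
them, whatever else is allocated. -/
theorem QProg.WellFormed.of_qubits_subset {sg : Sig} {A : Alloc sg} {Q : Finset (QCell sg)} :
    ∀ {p : QProg sg} {ρ : Env}, p.WellFormed A ρ → p.qubits ρ ⊆ Q → p.WellFormed ⟨Q, A.c⟩ ρ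
  | .skip, _, _, _ => trivial
  | .seq p q, ρ, hw, hQ => by
      rw [qubits] at hQ
      exact ⟨of_qubits_subset (p := p) hw.1 (Finset.union_subset_left hQ),
        of_qubits_subset (p := q) hw.2 (Finset.union_subset_right hQ)⟩
  | .loop y i j p, ρ, hw, hQ => by
      rw [qubits] at hQ
      exact fun k hk => of_qubits_subset (p := p) (hw k hk)
        (Finset.biUnion_subset.1 hQ k (List.mem_toFinset.2 hk))
  | .ite b p q, ρ, ⟨_, hc, dp, dq, hp, hq⟩, hQ => by
      rw [qubits] at hQ
      have hQ' := Finset.union_subset_right hQ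
      exact ⟨Finset.union_subset_left hQ, hc, dp, dq,
        of_qubits_subset (p := p) hp (Finset.union_subset_left hQ'),
        of_qubits_subset (p := q) hq (Finset.union_subset_right hQ')⟩
  | .apply G R, ρ, _, hQ => hQ

section Translation
variable {sg : Sig}

/-- A valuation of all classical variables as a function on addresses. -/
def allBits (w : ↥(Finset.univ : Finset (CCell sg)) → Bool) : CCell sg → Bool :=
  fun a => w ⟨a, Finset.mem_univ a⟩

theorem allBits_read (σ : CState sg) : allBits (σ.read Finset.univ) = σ.bits := rfl

open Classical in
/-- `Q *= U`; only unitary operators are of interest. -/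
noncomputable def Stmt.applyOp (Q : Finset (QCell sg)) (U : Matrix (Q → Bool) (Q → Bool) ℂ) :
    Stmt sg :=
  if hU : U ∈ Matrix.unitaryGroup (Q → Bool) ℂ then .unitary Q ⟨U, hU⟩ else .skip

/-- Case analysis on the values of all classical variables: `Q *= U v` for the actual value `v`. -/
noncomputable def Stmt.selectOp (Q : Finset (QCell sg))
    (U : (CCell sg → Bool) → Matrix (Q → Bool) (Q → Bool) ℂ) : Stmt sg :=
  (Finset.univ : Finset (↥(Finset.univ : Finset (CCell sg)) → Bool)).toList.foldl
    (fun S v => S.seq (.ite Finset.univ (fun w => decide (w = v))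
      (.applyOp Q (U (allBits v))) .skip)) .skip

/-- The values that are transferred to `C` when `Q` is measured. -/
def measBits (Q : List (QCell sg)) (C : List (CCell sg)) (w : QCell sg → Bool) :
    C.toFinset → Bool :=
  fun a => ((Q.map w)[C.idxOf a.1]?).getD false

/-- The projectors of the measurement of `Q` into `C`. -/
noncomputable def measProj (Q : List (QCell sg)) (C : List (CCell sg)) (i : C.toFinset → Bool) :
    Matrix (Q.toFinset → Bool) (Q.toFinset → Bool) ℂ :=
  Matrix.diagonal fun w => if measBits Q C (extendBits Q.toFinset w) = i then 1 else 0

theorem conjTranspose_measProj (Q : List (QCell sg)) (C : List (CCell sg))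
    (i : C.toFinset → Bool) : (measProj Q C i).conjTranspose = measProj Q C i := by
  rw [measProj, Matrix.diagonal_conjTranspose]
  congr 1; funext w
  simp only [Pi.star_apply]
  split_ifs <;> simp

/-- Each basis state has exactly one outcome; the registers need not have the same size. -/
theorem measProj_complete (Q : List (QCell sg)) (C : List (CCell sg)) :
    ∑ i, (measProj Q C i).conjTranspose * measProj Q C i = 1 := by
  ext w w'
  rw [Matrix.sum_apply]
  simp only [conjTranspose_measProj]
  simp only [measProj, Matrix.diagonal_mul_diagonal, Matrix.diagonal_apply, Matrix.one_apply]
  split_ifs <;> simp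

/-- The translation to qhl-cv. A quantum conditional has no counterpart there, so that a unitary
program becomes a case analysis on the classical variables, with one unitary operator per case. -/
noncomputable def Prog.toStmt : Env → Prog sg → Stmt sg
  | ρ, .init Q => (Q.cells ρ).foldl (fun S a => S.seq (.reset a)) .skip
  | ρ, .quantum p => .selectOp (p.qubits ρ) fun v => p.op (p.qubits ρ) v ρ
  | ρ, .seq p q => .seq (p.toStmt ρ) (q.toStmt ρ)
  | ρ, .loop x i j p => (loopRange (i.eval ρ) (j.eval ρ)).foldl
      (fun S k => S.seq (p.toStmt (Function.update ρ x k))) .skip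
  | ρ, .ite b p q =>
      .ite Finset.univ (fun w => b.value ρ (allBits w)) (p.toStmt ρ) (q.toStmt ρ)
  | ρ, .measure Q C => .meas (C.cells ρ).toFinset (Q.cells ρ).toFinset
      (measProj (Q.cells ρ) (C.cells ρ)) (measProj_complete _ _)
  | ρ, .oracle C₁ f C₂ => .assign (C₁.cells ρ).toFinset Finset.univ
      fun w a => f ((C₂.cells ρ).map (allBits w)) ((C₁.cells ρ).idxOf a.1)

theorem Stmt.foldl_seq_ne_abort {ι : Type*} (T : ι → Stmt sg) (l : List ι) (S : Stmt sg)
    (hS : S ≠ .abort) : l.foldl (fun S k => S.seq (T k)) S ≠ .abort := by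
  induction l generalizing S with
  | nil => exact hS
  | cons k l ih => exact ih _ (by simp)

theorem Prog.toStmt_ne_abort (ρ : Env) (p : Prog sg) : p.toStmt ρ ≠ .abort := by
  cases p with
  | init Q => rw [toStmt]; exact Stmt.foldl_seq_ne_abort _ _ _ (by simp)
  | quantum p => rw [toStmt]; exact Stmt.foldl_seq_ne_abort _ _ _ (by simp)
  | loop x i j p => rw [toStmt]; exact Stmt.foldl_seq_ne_abort _ _ _ (by simp)
  | seq p q => simp [toStmt]
  | ite b p q => simp [toStmt]
  | measure Q C => simp [toStmt]
  | oracle C₁ f C₂ => simp [toStmt]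

/-! ### Denotations of translated programs -/

theorem Stmt.sem_foldl_seq {ι : Type*} (T : ι → Stmt sg) (l : List ι) (S : Stmt sg)
    (Δ : CQMap sg) : (l.foldl (fun S k => S.seq (T k)) S).sem Δ =
      l.foldl (fun Δ k => (T k).sem Δ) (S.sem Δ) := by
  induction l generalizing S with
  | nil => rfl
  | cons k l ih => rw [List.foldl_cons, ih]; rfl

/-- Unitary statements leave the classical variables alone, so that exactly one of the cases applies. -/
theorem Stmt.sem_selectOp {Q : Finset (QCell sg)}
    {U : (CCell sg → Bool) → Matrix (Q → Bool) (Q → Bool) ℂ}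
    (hU : ∀ v, U v ∈ Matrix.unitaryGroup (Q → Bool) ℂ) (Δ : CQMap sg) (σ : CState sg) :
    (Stmt.selectOp Q U).sem Δ σ =
      liftOp Q (U σ.bits) * Δ σ * (liftOp Q (U σ.bits)).conjTranspose := by
  have step : ∀ (v : ↥(Finset.univ : Finset (CCell sg)) → Bool) (Δ : CQMap sg),
      (Stmt.ite Finset.univ (fun w => decide (w = v)) (.applyOp Q (U (allBits v))) .skip).sem Δ σ =
        if σ.read Finset.univ = v then
          liftOp Q (U σ.bits) * Δ σ * (liftOp Q (U σ.bits)).conjTranspose else Δ σ := by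
    intro v Δ
    rw [Stmt.sem, Stmt.applyOp, dif_pos (hU _), Pi.add_apply]
    simp only [Stmt.sem, CQMap.guard]
    by_cases hv : σ.read Finset.univ = v
    · subst hv
      simp [allBits_read]
    · simp [hv]
  have key : ∀ l : List (↥(Finset.univ : Finset (CCell sg)) → Bool), l.Nodup → ∀ Δ : CQMap sg,
      l.foldl (fun Δ v => (Stmt.ite Finset.univ (fun w => decide (w = v))
        (.applyOp Q (U (allBits v))) .skip).sem Δ) Δ σ = if σ.read Finset.univ ∈ l then
          liftOp Q (U σ.bits) * Δ σ * (liftOp Q (U σ.bits)).conjTranspose else Δ σ := by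
    intro l
    induction l with
    | nil => simp
    | cons v l ih =>
      intro hl Δ
      rw [List.nodup_cons] at hl
      rw [List.foldl_cons, ih hl.2, step]
      by_cases hv : σ.read Finset.univ = v
      · simp [hv, hl.1]
      · simp [hv]
  rw [Stmt.selectOp, Stmt.sem_foldl_seq, key _ (Finset.nodup_toList _)]
  simp [Stmt.sem]

end Translation

namespace HPS
variable {sg : Sig} {x : ℕ → Bool}

theorem QStep.densityOp_eq {Q : Finset (QCell sg)}
    {U : (CCell sg → Bool) → Matrix (Q → Bool) (Q → Bool) ℂ} {h h' : HPS sg}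
    (s : QStep x Q U h h') (c : CState sg) : h'.densityOp x c =
      liftOp Q (U c.bits) * h.densityOp x c * (liftOp Q (U c.bits)).conjTranspose := by
  rw [h.densityOp_eq_sum_psi x c (N := h.reached x ∪ h'.reached x) Finset.subset_union_left,
    h'.densityOp_eq_sum_psi x c (N := h.reached x ∪ h'.reached x) Finset.subset_union_right,
    Finset.mul_sum, Finset.sum_mul]
  refine Finset.sum_congr rfl fun η _ => ?_
  split_ifs with hc
  · rw [s.psi, hc, Matrix.mul_vecMulVec, Matrix.vecMulVec_mul, Matrix.star_mulVec]
  · simp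

theorem QStep.mass_eq {Q : Finset (QCell sg)}
    {U : (CCell sg → Bool) → Matrix (Q → Bool) (Q → Bool) ℂ} {h h' : HPS sg}
    (s : QStep x Q U h h') (hQ : Q ⊆ h.alloc.q)
    (hU : ∀ v, U v ∈ Matrix.unitaryGroup (Q → Bool) ℂ) : h'.mass x = h.mass x := by
  refine Finset.sum_congr rfl fun c _ => ?_
  have e := Matrix.mem_unitaryGroup_iff'.1 (hU c.bits)
  rw [Matrix.star_eq_conjTranspose] at e
  rw [s.densityOp_eq, Matrix.trace_mul_comm, ← Matrix.mul_assoc, liftOp_conjTranspose, liftOp_mul,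
    e, liftOp_one_mul]
  intro m m' hm
  rw [(densityOp_apply_ne_zero hm).1]
  exact hQ

/-! ### New rows of the classical stack -/

theorem lookup_zip {α β : Type*} [BEq α] [LawfulBEq α] (a : α) : ∀ (C : List α) (b : List β),
    b.length ≤ C.length → (C.zip b).lookup a = b[C.idxOf a]?
  | [], [], _ => by simp
  | [], _ :: _, h => by simp at h
  | _ :: _, [], _ => by simp
  | c :: C, d :: b, h => by
    by_cases e : a = c
    · subst e; simp
    · have e' : (a == c) = false := by simpa using e
      have e'' : (c == a) = false := by simpa using Ne.symm e
      rw [List.zip_cons_cons, List.lookup_cons, e']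
      simp only [List.idxOf_cons, e'', cond_false, List.getElem?_cons_succ]
      exact lookup_zip a C b (by simpa using h)

theorem push_history (h : HPS sg) (v : SVar → Bool) (C : List (CCell sg)) (b : List BExp)
    (hl : b.length = C.length) (w : C.toFinset → Bool)
    (hw : ∀ a : C.toFinset, ((b.map (BExp.eval v))[C.idxOf a.1]?).getD false = w a) :
    (h.push C b).history v = (h.history v).present.write C.toFinset w :: h.history v := by
  change (_ :: _ : List _) = _ :: h.history v
  congr 1
  funext a
  change ((List.lookup a (C.zip b)).or (HMem.top h.o.c a)).map (BExp.eval v) = _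
  rw [lookup_zip _ _ _ hl.le, CState.write]
  by_cases ha : a ∈ C
  · have hi : C.idxOf a < b.length := hl ▸ List.idxOf_lt_length_of_mem ha
    have := hw ⟨a, List.mem_toFinset.2 ha⟩
    rw [dif_pos (List.mem_toFinset.2 ha), ← this]
    simp [hi]
  · rw [dif_neg (by simpa using ha), List.idxOf_of_notMem ha, ← hl, present_history]
    simp

theorem write_injective (σ : CState sg) (X : Finset (CCell sg)) :
    Function.Injective (σ.write X) := by
  intro w w' e
  funext a
  simpa [CState.write] using congrFun e a.1

/-- `h'` arises from `h` by a new classical row, in which the cells of `X` hold the bits `i` of the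
present classical memory and of the basis state. -/
structure PushStep (x : ℕ → Bool) (X : Finset (CCell sg))
    (i : CState sg → QState sg → X → Bool) (h h' : HPS sg) : Prop where
  su : h'.su = h.su
  amp : ∀ t, h'.amp x t = h.amp x t
  qval : ∀ t, h'.qval (val x t) = h.qval (val x t)
  history : ∀ t, h'.history (val x t) = (h.history (val x t)).present.write X
    (i (h.history (val x t)).present (h.qval (val x t))) :: h.history (val x t)

theorem PushStep.isLocal {X : Finset (CCell sg)} {i : CState sg → QState sg → X → Bool}
    {h h' : HPS sg} (s : PushStep x X i h h') (l : h.Local x) : h'.Local x where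
  amp t t' e := by rw [s.amp, s.amp]; rw [s.su] at e; exact l.amp t t' e
  qval t t' e := by rw [s.qval, s.qval]; rw [s.su] at e; exact l.qval t t' e
  history t t' e := by
    rw [s.su] at e
    rw [s.history, s.history, l.history t t' e, l.qval t t' e]

/-- As the new row determines the bits `i` once the old history is given, two paths interfere after the
step if they did before and agree on `i`. -/
theorem PushStep.densityOp_eq {X : Finset (CCell sg)} {i : CState sg → QState sg → X → Bool}
    {h h' : HPS sg} (s : PushStep x X i h h') (c : CState sg) (m m' : QState sg) :
    h'.densityOp x c m m' = ∑ σ, if i σ m = i σ m' ∧ σ.write X (i σ m) = c then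
      h.densityOp x σ m m' else 0 := by
  have e : ∀ σ, (if i σ m = i σ m' ∧ σ.write X (i σ m) = c then h.densityOp x σ m m' else 0) =
      ∑ t₁ ∈ h.su.powerset, ∑ t₂ ∈ h.su.powerset,
        if i σ m = i σ m' ∧ σ.write X (i σ m) = c then
          (if h.history (val x t₁) = h.history (val x t₂) ∧ (h.history (val x t₁)).present = σ then
            Matrix.single (h.qval (val x t₁)) (h.qval (val x t₂))
              (h.amp x t₁ * star (h.amp x t₂)) else 0) m m' else 0 := by
    intro σ
    rw [densityOp_apply]
    simp only [Matrix.sum_apply]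
    split_ifs <;> simp
  rw [densityOp_apply, Finset.sum_congr rfl fun σ _ => e σ, s.su]
  simp only [Matrix.sum_apply]
  refine (Finset.sum_comm.trans (Finset.sum_congr rfl fun t₁ _ =>
    Finset.sum_comm.trans (Finset.sum_congr rfl fun t₂ _ => ?_))).symm
  symm
  rw [s.amp, s.amp, s.qval, s.qval, s.history, s.history]
  generalize h.history (val x t₁) = k₁
  generalize h.history (val x t₂) = k₂
  generalize h.qval (val x t₁) = q₁
  generalize h.qval (val x t₂) = q₂
  by_cases hm : q₁ = m ∧ q₂ = m'
  · obtain ⟨rfl, rfl⟩ := hm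
    rw [Finset.sum_eq_single k₁.present]
    · by_cases hk : k₁ = k₂
      · subst hk
        by_cases hi : i k₁.present q₁ = i k₁.present q₂
        · have hp : ∀ r : CState sg, History.present (r :: k₁) = r := fun _ => rfl
          simp only [hi, hp, true_and]
          split_ifs <;> simp
        · have : ¬ k₁.present.write X (i k₁.present q₁) =
              k₁.present.write X (i k₁.present q₂) := fun e => hi (write_injective _ _ e)
          simp [hi, this]
      · simp [hk]
    · intro σ _ hσ
      simp [hσ.symm]
    · simp
  · have : ∀ z : ℂ, Matrix.single q₁ q₂ z m m' = 0 := fun z => by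
      rw [Matrix.single_apply, if_neg hm]
    symm
    rw [Finset.sum_eq_zero]
    · split_ifs
      · rw [this]
      · rfl
    · intro σ _
      split_ifs
      · exact this _
      · rfl
      · rfl

theorem PushStep.mass_eq {X : Finset (CCell sg)} {i : CState sg → QState sg → X → Bool}
    {h h' : HPS sg} (s : PushStep x X i h h') : h'.mass x = h.mass x := by
  simp only [mass, Matrix.trace, Matrix.diag_apply, s.densityOp_eq, true_and]
  rw [Finset.sum_comm]
  conv_rhs => rw [Finset.sum_comm]
  refine Finset.sum_congr rfl fun m _ => ?_
  rw [Finset.sum_comm]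
  simp

/-! ### Initialization -/

theorem resetOp_mul_single_mul (a : QCell sg) (n : Option Bool) (q q' : QState sg) (z : ℂ) :
    resetOp a n * Matrix.single q q' z * (resetOp a n).conjTranspose =
      if q a = n ∧ q' a = n then
        Matrix.single (Function.update q a (some false)) (Function.update q' a (some false)) z
      else 0 := by
  ext m m'
  rw [Matrix.mul_apply, Finset.sum_eq_single q']
  · rw [Matrix.mul_apply, Finset.sum_eq_single q]
    · rw [Matrix.single_apply_same, Matrix.conjTranspose_apply, resetOp, resetOp]
      by_cases h1 : q a = n <;> by_cases h2 : q' a = n <;>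
        simp only [h1, h2, true_and, false_and, and_false, if_true, if_false, zero_mul, star_zero,
          mul_zero, Matrix.zero_apply]
      rw [Matrix.single_apply]
      by_cases h3 : m = Function.update q a (some false) <;>
        by_cases h4 : m' = Function.update q' a (some false) <;> simp [h3, h4, eq_comm]
    · intro k _ hk
      rw [Matrix.single_apply_of_row_ne hk.symm, mul_zero]
    · simp
  · intro k _ hk
    rw [Matrix.mul_apply, Finset.sum_eq_zero, zero_mul]
    intro j _
    rw [Matrix.single_apply_of_col_ne _ _ hk.symm, mul_zero]
  · simp

section setQ
variable {h : HPS sg} {a : QCell sg}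

theorem Local.setQ_zero (l : h.Local x) : (h.setQ a BExp.zero).Local x where
  amp := l.amp
  qval t t' e := by rw [setQ_qval, setQ_qval, l.qval t t' e]; rfl
  history := l.history

theorem qval_eq_none (ha : a ∉ h.alloc.q) (v : SVar → Bool) : h.qval v a = none := by
  rw [← h.dom_qval v, QState.mem_dom] at ha
  simpa using ha

/-- On an unallocated qubit, only the term `|0⟩⟨n|` with `n` the hole contributes to the reset. -/
theorem densityOp_setQ_zero (ha : a ∉ h.alloc.q) (c : CState sg) :
    (h.setQ a BExp.zero).densityOp x c =
      ∑ n, resetOp a n * h.densityOp x c * (resetOp a n).conjTranspose := by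
  have : ∀ n, resetOp a n * h.densityOp x c * (resetOp a n).conjTranspose =
      if n = none then (h.setQ a BExp.zero).densityOp x c else 0 := by
    intro n
    rw [densityOp_apply, densityOp_apply]
    simp only [Finset.mul_sum, Finset.sum_mul, mul_ite, ite_mul, mul_zero, zero_mul,
      resetOp_mul_single_mul, qval_eq_none ha, setQ_qval, and_self]
    cases n with
    | none => simp only [if_true]; rfl
    | some d => simp
  simp [this]

theorem mass_setQ_zero (ha : a ∉ h.alloc.q) : (h.setQ a BExp.zero).mass x = h.mass x := by
  refine Finset.sum_congr rfl fun c => fun _ => ?_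
  rw [densityOp_apply, densityOp_apply, Matrix.trace_sum, Matrix.trace_sum]
  refine Finset.sum_congr rfl fun t₁ _ => ?_
  rw [Matrix.trace_sum, Matrix.trace_sum]
  refine Finset.sum_congr rfl fun t₂ _ => ?_
  change (if h.history (val x t₁) = h.history (val x t₂) ∧
    (h.history (val x t₁)).present = c then _ else _ : Matrix _ _ _).trace = _
  split_ifs
  · by_cases e : h.qval (val x t₁) = h.qval (val x t₂)
    · rw [setQ_qval, setQ_qval, e, BExp.eval, BExp.eval, Matrix.trace_single_eq_same,
        Matrix.trace_single_eq_same]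
      rfl
    · rw [setQ_qval, setQ_qval, Matrix.trace_single_eq_of_ne _ _ _ e,
        Matrix.trace_single_eq_of_ne]
      -- Both memories have a hole at `a`, hence the overwritten memories differ elsewhere.
      intro e'
      refine e (funext fun b => ?_)
      by_cases hb : b = a
      · rw [hb, qval_eq_none ha, qval_eq_none ha]
      · simpa [hb] using congrFun e' b
  · rfl

end setQ

/-! ### Classical conditionals -/

theorem densityOp_restrict {h : HPS sg} {e : BExp} {d : Bool} (b : (CCell sg → Bool) → Bool)
    (he : ∀ t, e.eval (val x t) = decide (b (h.history (val x t)).present.bits = d)) :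
    (h.restrict e).densityOp x =
      CQMap.guard Finset.univ (fun w => b (allBits w)) d (h.densityOp x) := by
  funext c
  rw [CQMap.guard, allBits_read, densityOp_apply, densityOp_apply]
  by_cases hd : b c.bits = d
  · rw [if_pos hd]
    refine Finset.sum_congr rfl fun t₁ _ => Finset.sum_congr rfl fun t₂ _ => ?_
    change (if h.history (val x t₁) = h.history (val x t₂) ∧
      (h.history (val x t₁)).present = c then _ else _) = _
    split_ifs with hc
    · rw [restrict_amp, restrict_amp, he, he, ← hc.1, hc.2, decide_eq_true hd, if_pos rfl,
        if_pos rfl]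
      rfl
    · rfl
  · rw [if_neg hd]
    refine Finset.sum_eq_zero fun t₁ _ => Finset.sum_eq_zero fun t₂ _ => ?_
    change (if h.history (val x t₁) = h.history (val x t₂) ∧
      (h.history (val x t₁)).present = c then _ else _) = _
    split_ifs with hc
    · rw [restrict_amp, he, hc.2, decide_eq_false hd]
      simp
    · rfl

/-- If no history is common to the two summands, then there is no interference between them. -/
theorem densityOp_plus {h₁ h₂ : HPS sg} (l₁ : h₁.Local x) (l₂ : h₂.Local x)
    (ha : h₁.alloc = h₂.alloc)
    (hd : ∀ t t', h₁.amp x t ≠ 0 → h₂.amp x t' ≠ 0 →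
      mergeHist h₂.cshape (h₁.history (val x t)) ≠ mergeHist h₁.cshape (h₂.history (val x t')))
    (c : CState sg) :
    (h₁.plus h₂).densityOp x c = h₁.densityOp x c + h₂.densityOp x c := by
  have hq := congrArg Alloc.q ha
  have p₁ : ∀ t, (mergeHist h₂.cshape (h₁.history (val x t))).present =
      (h₁.history (val x t)).present := fun t => present_mergeHist <| by
    rw [headD_cshape, rowShape_present_history, ha]
  have p₂ : ∀ t, (mergeHist h₁.cshape (h₂.history (val x t))).present =
      (h₂.history (val x t)).present := fun t => present_mergeHist <| by
    rw [headD_cshape, rowShape_present_history, ha]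
  have i₁ : ∀ t t', mergeHist h₂.cshape (h₁.history (val x t)) =
      mergeHist h₂.cshape (h₁.history (val x t')) ↔
      h₁.history (val x t) = h₁.history (val x t') := fun t t' =>
    ⟨mergeHist_injective (by rw [map_rowShape_history, map_rowShape_history]), fun e => by rw [e]⟩
  have i₂ : ∀ t t', mergeHist h₁.cshape (h₂.history (val x t)) =
      mergeHist h₁.cshape (h₂.history (val x t')) ↔
      h₂.history (val x t) = h₂.history (val x t') := fun t t' =>
    ⟨mergeHist_injective (by rw [map_rowShape_history, map_rowShape_history]), fun e => by rw [e]⟩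
  rw [densityOp_eq_pathSum, pathSum_plus l₁ l₂ hq]
  · have key := fun (α : ℂ) (k : History sg) (q : QState sg) =>
      pathSum_plus l₁ l₂ hq (fun α' k' q' => if k = k' ∧ k.present = c then
        Matrix.single q q' (α * star α') else 0) (by intros; simp)
    simp only [key]
    rw [densityOp_eq_pathSum, densityOp_eq_pathSum]
    congr 1
    · refine Finset.sum_congr rfl fun t _ => ?_
      beta_reduce
      rw [add_eq_left.2]
      · refine Finset.sum_congr rfl fun t' _ => ?_
        simp only [i₁, p₁]
      · refine Finset.sum_eq_zero fun t' _ => ?_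
        beta_reduce
        split_ifs with hc
        · by_cases z : h₁.amp x t = 0
          · simp [z]
          · by_cases z' : h₂.amp x t' = 0
            · simp [z']
            · exact absurd hc.1 (hd t t' z z')
        · rfl
    · refine Finset.sum_congr rfl fun t _ => ?_
      beta_reduce
      rw [add_eq_right.2]
      · refine Finset.sum_congr rfl fun t' _ => ?_
        simp only [i₂, p₂]
      · refine Finset.sum_eq_zero fun t' _ => ?_
        beta_reduce
        split_ifs with hc
        · by_cases z : h₂.amp x t = 0
          · simp [z]
          · by_cases z' : h₁.amp x t' = 0
            · simp [z']
            · exact absurd hc.1.symm (hd t' t z' z)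
        · rfl
  · intros
    exact Finset.sum_eq_zero fun _ _ => by simp

end HPS

/-! ### Soundness -/

section Soundness
variable {sg : Sig} {x : ℕ → Bool}

/-- `h'` is the result of a program with translation `S`, run on `h`. Besides the density operators,
this records that the classical stack only grows and that no path of amplitude zero is revived:
histories that are reached under contradictory guards thus stay distinct. -/
structure Sound (x : ℕ → Bool) (S : Stmt sg) (h h' : HPS sg) : Prop where
  isLocal : h'.Local x
  cshape : h.cshape <:+ h'.cshape
  history : ∀ t, h.history (val x t) <:+ h'.history (val x t)
  amp : ∀ t, h.amp x t = 0 → h'.amp x t = 0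
  densityOp : h'.densityOp x = S.sem (h.densityOp x)
  mass : h'.mass x = h.mass x

theorem Sound.refl {h : HPS sg} (l : h.Local x) : Sound x .skip h h :=
  ⟨l, List.suffix_rfl, fun _ => List.suffix_rfl, fun _ => id, rfl, rfl⟩

theorem Sound.trans {S T : Stmt sg} {h h' h'' : HPS sg} (s : Sound x S h h')
    (s' : Sound x T h' h'') : Sound x (.seq S T) h h'' :=
  ⟨s'.isLocal, s.cshape.trans s'.cshape, fun t => (s.history t).trans (s'.history t),
    fun t ht => s'.amp t (s.amp t ht), by rw [s'.densityOp, s.densityOp]; rfl,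
    s'.mass.trans s.mass⟩

open HPS

theorem Sound.quantum {h : HPS sg} (l : h.Local x) {ρ : Env} {p : QProg sg}
    (hw : p.WellFormed h.alloc ρ) :
    Sound x ((Prog.quantum p).toStmt ρ) h (p.run ρ h) ∧ (p.run ρ h).alloc = h.alloc := by
  have hU := fun v => p.op_mem_unitaryGroup (Q := p.qubits ρ) v ρ hw
  have s := p.run_step ρ h (hw.of_qubits_subset Finset.Subset.rfl) l hw.qubits_subset
  refine ⟨⟨s.isLocal, ?_, fun t => ?_, s.amp, ?_, s.mass_eq hw.qubits_subset hU⟩, s.alloc⟩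
  · rw [s.cshape]
  · rw [s.history]
  · funext σ
    rw [Prog.toStmt, Stmt.sem_selectOp hU, s.densityOp_eq]

theorem Sound.init {h : HPS sg} (l : h.Local x) {a : QCell sg} (ha : a ∉ h.alloc.q) :
    Sound x (.reset a) h (h.setQ a BExp.zero) :=
  ⟨l.setQ_zero, List.suffix_rfl, fun _ => List.suffix_rfl, fun _ => id,
    funext fun c => densityOp_setQ_zero ha c, mass_setQ_zero ha⟩

theorem Sound.initRegister : ∀ (L : List (QCell sg)), L.Nodup → ∀ {h h' : HPS sg} {S : Stmt sg},
    Sound x S h h' → Disjoint L.toFinset h'.alloc.q →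
      Sound x (L.foldl (fun S a => S.seq (.reset a)) S) h
        (L.foldl (fun h a => h.setQ a BExp.zero) h') ∧
      (L.foldl (fun h a => h.setQ a BExp.zero) h').alloc = ⟨h'.alloc.q ∪ L.toFinset, h'.alloc.c⟩
  | [], _, h, h', S, s, _ => ⟨s, by simp⟩
  | a :: L, hL, h, h', S, s, hd => by
      rw [List.nodup_cons] at hL
      rw [List.toFinset_cons, Finset.disjoint_insert_left] at hd
      obtain ⟨s', ha⟩ := initRegister L hL.2 (s.trans (Sound.init s.isLocal hd.1)) (by
        rw [setQ_alloc, Finset.disjoint_insert_right]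
        exact ⟨by simpa using hL.1, hd.2⟩)
      refine ⟨s', ha.trans ?_⟩
      rw [setQ_alloc, List.toFinset_cons, Finset.insert_union, Finset.union_insert]

theorem HPS.PushStep.sound {X : Finset (CCell sg)} {i : CState sg → QState sg → X → Bool}
    {h h' : HPS sg} (s : PushStep x X i h h') (l : h.Local x) {S : Stmt sg}
    (hS : h'.densityOp x = S.sem (h.densityOp x)) : Sound x S h h' where
  isLocal := s.isLocal l
  history t := by rw [s.history]; exact List.suffix_cons _ _
  cshape := by
    rw [← h.map_rowShape_history (val x ∅), ← h'.map_rowShape_history (val x ∅), s.history]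
    exact List.suffix_cons _ _
  amp t ht := by rw [s.amp, ht]
  densityOp := hS
  mass := s.mass_eq

theorem HPS.PushStep.alloc {X : Finset (CCell sg)} {i : CState sg → QState sg → X → Bool}
    {h h' : HPS sg} (s : PushStep x X i h h') : h'.alloc = ⟨h.alloc.q, h.alloc.c ∪ X⟩ := by
  have hq : h'.alloc.q = h.alloc.q := by
    rw [← h.dom_qval (val x ∅), ← h'.dom_qval (val x ∅), s.qval]
  have hc : h'.alloc.c = h.alloc.c ∪ X := by
    have h1 := h'.rowShape_present_history (val x ∅)
    have h2 := h.rowShape_present_history (val x ∅)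
    rw [s.history] at h1
    ext a
    have e1 := congrFun h1 a
    have e2 := congrFun h2 a
    simp only [History.present, List.headD_cons, rowShape, CState.write] at e1 e2
    rw [Finset.mem_union]
    by_cases ha : a ∈ X
    · simpa [ha] using e1.symm
    · rw [dif_neg ha, e2] at e1
      simpa [ha] using e1.symm
  cases e : h'.alloc
  rw [e] at hq hc
  simp only at hq hc
  rw [hq, hc]

theorem measure_pushStep (h : HPS sg) (Q : List (QCell sg)) (C : List (CCell sg))
    (hl : Q.length = C.length) : PushStep x C.toFinset
      (fun _ m => measBits Q C fun a => (m a).getD false) h (h.push C (Q.map h.curQ)) where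
  su := rfl
  amp _ := rfl
  qval _ := rfl
  history t := by
    refine push_history h _ C _ (by simpa using hl) _ fun a => ?_
    rw [measBits, List.map_map]
    congr 3
    funext a
    exact h.eval_curQ _ a

theorem Sound.measure {h : HPS sg} (l : h.Local x) {ρ : Env} {Q : QReg sg} {C : CReg sg}
    (hQ : (Q.cells ρ).toFinset ⊆ h.alloc.q) (hl : (Q.cells ρ).length = (C.cells ρ).length) :
    Sound x ((Prog.measure Q C).toStmt ρ) h (h.push (C.cells ρ) ((Q.cells ρ).map h.curQ)) := by
  have s := measure_pushStep (x := x) h (Q.cells ρ) (C.cells ρ) hl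
  refine s.sound l (funext fun c => ?_)
  ext m m'
  rw [s.densityOp_eq, Prog.toStmt, Stmt.sem]
  beta_reduce
  rw [Matrix.sum_apply]
  refine Finset.sum_congr rfl fun σ _ => ?_
  have hb : ∀ m : QState sg, measBits (Q.cells ρ) (C.cells ρ)
      (extendBits _ (m.bits (Q.cells ρ).toFinset)) =
      measBits (Q.cells ρ) (C.cells ρ) fun a => (m a).getD false := by
    intro m
    funext a
    rw [measBits, measBits, List.map_congr_left]
    intro q hq
    simp [extendBits, QState.bits, hq]
  have hp : ∀ i, (liftOp (Q.cells ρ).toFinset (measProj (Q.cells ρ) (C.cells ρ) i) *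
      h.densityOp x σ *
      (liftOp (Q.cells ρ).toFinset (measProj (Q.cells ρ) (C.cells ρ) i)).conjTranspose) m m' =
      if measBits (Q.cells ρ) (C.cells ρ) (fun a => (m a).getD false) = i ∧
        measBits (Q.cells ρ) (C.cells ρ) (fun a => (m' a).getD false) = i then
        h.densityOp x σ m m' else 0 := by
    intro i
    rw [liftOp_conjTranspose, conjTranspose_measProj, measProj, liftOp_diagonal,
      Matrix.mul_diagonal, Matrix.diagonal_mul]
    by_cases z : h.densityOp x σ m m' = 0
    · simp [z]
    · have d₁ : (Q.cells ρ).toFinset ⊆ m.dom := by rw [(densityOp_apply_ne_zero z).1]; exact hQ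
      have d₂ : (Q.cells ρ).toFinset ⊆ m'.dom := by rw [(densityOp_apply_ne_zero z).2]; exact hQ
      rw [if_pos d₁, if_pos d₂, hb m, hb m']
      by_cases h1 : measBits (Q.cells ρ) (C.cells ρ) (fun a => (m a).getD false) = i <;>
        by_cases h2 : measBits (Q.cells ρ) (C.cells ρ) (fun a => (m' a).getD false) = i <;>
          simp [h1, h2]
  -- Only the outcome read off `m` contributes.
  rw [Matrix.sum_apply, Finset.sum_eq_single
    (measBits (Q.cells ρ) (C.cells ρ) fun a => (m a).getD false)]
  · by_cases hc : σ.write _ (measBits (Q.cells ρ) (C.cells ρ) fun a => (m a).getD false) = c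
    · rw [if_pos hc, hp]
      simp [hc, eq_comm]
    · simp [hc]
  · intro i _ hi
    split_ifs
    · rw [hp, if_neg fun e => hi e.1.symm]
    · rfl
  · simp

theorem oracle_pushStep (h : HPS sg) (C₁ C₂ : List (CCell sg)) (f : List Bool → ℕ → Bool) :
    PushStep x C₁.toFinset (fun σ _ a => f (C₂.map σ.bits) (C₁.idxOf a.1)) h
      (h.push C₁ ((List.range C₁.length).map fun k =>
        BExp.ofFun (C₂.map h.curC) fun l => f l k)) where
  su := rfl
  amp _ := rfl
  qval _ := rfl
  history t := by
    refine push_history h _ C₁ _ (by simp) _ fun a => ?_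
    have ha : C₁.idxOf a.1 < C₁.length :=
      List.idxOf_lt_length_of_mem (List.mem_toFinset.1 a.2)
    rw [List.getElem?_map, List.getElem?_map, List.getElem?_range ha]
    simp only [Option.map_some, Option.getD_some, BExp.eval_ofFun, List.map_map]
    congr 2
    funext a
    exact h.eval_curC _ a

theorem Sound.oracle {h : HPS sg} (l : h.Local x) (ρ : Env) (C₁ C₂ : CReg sg)
    (f : List Bool → ℕ → Bool) :
    Sound x ((Prog.oracle C₁ f C₂).toStmt ρ) h ((Prog.oracle C₁ f C₂).run ρ h) := by
  have s := oracle_pushStep (x := x) h (C₁.cells ρ) (C₂.cells ρ) f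
  rw [Prog.run]
  refine s.sound l (funext fun c => ?_)
  ext m m'
  rw [s.densityOp_eq, Prog.toStmt, Stmt.sem]
  beta_reduce
  rw [Matrix.sum_apply]
  refine Finset.sum_congr rfl fun σ _ => ?_
  rw [allBits_read]
  simp only [true_and]
  split_ifs <;> rfl

/-- The guard is a function of the present row of the history in `h`, a suffix of the histories of both
branches, so that no history of nonzero amplitude is common to them. -/
theorem Sound.ite {h h₁ h₂ : HPS sg} {b : CBool sg} {ρ : Env} {S₁ S₂ : Stmt sg}
    (s₁ : Sound x S₁ (h.restrict (b.sym ρ h)) h₁)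
    (s₂ : Sound x S₂ (h.restrict (BExp.xor BExp.one (b.sym ρ h))) h₂)
    (ha : h₁.alloc = h₂.alloc) :
    Sound x (.ite Finset.univ (fun w => b.value ρ (allBits w)) S₁ S₂) h (h₁.plus h₂) := by
  have e₁ : ∀ t, (b.sym ρ h).eval (val x t) =
      decide (b.value ρ (h.history (val x t)).present.bits = true) := fun t => by
    rw [b.eval_sym]; simp
  have e₂ : ∀ t, (BExp.xor BExp.one (b.sym ρ h)).eval (val x t) =
      decide (b.value ρ (h.history (val x t)).present.bits = false) := fun t => by
    rw [BExp.eval, b.eval_sym]; simp [BExp.eval]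
  have suf₁ : ∀ t, h.history (val x t) <:+ mergeHist h₂.cshape (h₁.history (val x t)) := fun t =>
    suffix_mergeHist (s₁.history t) (by rw [map_rowShape_history]; exact s₂.cshape)
  have suf₂ : ∀ t, h.history (val x t) <:+ mergeHist h₁.cshape (h₂.history (val x t)) := fun t =>
    suffix_mergeHist (s₂.history t) (by rw [map_rowShape_history]; exact s₁.cshape)
  have hd : ∀ t t', h₁.amp x t ≠ 0 → h₂.amp x t' ≠ 0 →
      mergeHist h₂.cshape (h₁.history (val x t)) ≠
        mergeHist h₁.cshape (h₂.history (val x t')) := by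
    intro t t' z z' e
    have base : h.history (val x t) = h.history (val x t') :=
      suffix_unique (suf₁ t) (e ▸ suf₂ t')
        (by rw [length_history, length_history])
    have g₁ : b.value ρ (h.history (val x t)).present.bits = true := by
      by_contra hb
      exact z (s₁.amp t (by rw [restrict_amp, e₁, decide_eq_false hb]; simp))
    have g₂ : b.value ρ (h.history (val x t')).present.bits = false := by
      by_contra hb
      exact z' (s₂.amp t' (by rw [restrict_amp, e₂, decide_eq_false hb]; simp))
    rw [base, g₂] at g₁
    exact Bool.noConfusion g₁
  have hD := densityOp_plus s₁.isLocal s₂.isLocal ha hd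
  have hR : ∀ c, (h.restrict (b.sym ρ h)).densityOp x c +
      (h.restrict (BExp.xor BExp.one (b.sym ρ h))).densityOp x c = h.densityOp x c := by
    intro c
    rw [densityOp_restrict (b.value ρ) e₁, densityOp_restrict (b.value ρ) e₂, CQMap.guard,
      CQMap.guard]
    cases b.value ρ (allBits (c.read Finset.univ)) <;> simp
  refine ⟨s₁.isLocal.plus s₂.isLocal (congrArg Alloc.q ha), ?_, fun t => ?_, fun t ht => ?_, ?_, ?_⟩
  · have := (suf₁ {branchVar h₁ h₂}).map rowShape
    have e := (h₁.plus h₂).map_rowShape_history (val x {branchVar h₁ h₂})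
    rw [plus_history, if_pos (Finset.mem_singleton_self _)] at e
    rwa [e, map_rowShape_history] at this
  · rw [plus_history]
    split_ifs
    · exact suf₁ t
    · exact suf₂ t
  · rw [plus_amp, s₁.amp t (by rw [restrict_amp, ht, ite_self]),
      s₂.amp t (by rw [restrict_amp, ht, ite_self])]
    simp
  · funext c
    rw [hD, s₁.densityOp, s₂.densityOp, densityOp_restrict (b.value ρ) e₁,
      densityOp_restrict (b.value ρ) e₂]
    rfl
  · have : (h₁.plus h₂).mass x = h₁.mass x + h₂.mass x := by
      simp only [HPS.mass, hD, Matrix.trace_add, Finset.sum_add_distrib]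
    rw [this, s₁.mass, s₂.mass]
    simp only [HPS.mass, ← hR, Matrix.trace_add, Finset.sum_add_distrib]

theorem QReg.nodup_cells (ρ : Env) : ∀ Q : QReg sg, (Q.cells ρ).Nodup
  | .ident r => by
      rw [cells]
      exact (List.nodup_finRange _).map fun i j e => by simpa using e
  | .drop Q i => by rw [cells]; exact (nodup_cells ρ Q).sublist (List.drop_sublist _ _)
  | .take Q i => by rw [cells]; exact (nodup_cells ρ Q).sublist (List.take_sublist _ _)
  | .slice Q i j => by
      rw [cells]
      exact (nodup_cells ρ Q).sublist ((List.drop_sublist _ _).trans (List.take_sublist _ _))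
  | .get Q i => by
      rw [cells]
      exact (nodup_cells ρ Q).sublist ((List.take_sublist _ _).trans (List.drop_sublist _ _))

theorem Prog.foldl_profile_none {ι : Type*} (f : ι → Alloc sg → Option (Alloc sg)) (l : List ι) :
    l.foldl (fun r k => r.bind (f k)) none = none := by
  induction l with
  | nil => rfl
  | cons k l ih => exact ih

theorem Sound.foldl {ι : Type*} (f : ι → Alloc sg → Option (Alloc sg)) (run : ι → HPS sg → HPS sg)
    (T : ι → Stmt sg)
    (hf : ∀ k A' (h : HPS sg), f k h.alloc = some A' → h.Local x →
      Sound x (T k) h (run k h) ∧ (run k h).alloc = A') :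
    ∀ (l : List ι) {h h' : HPS sg} {S : Stmt sg} {A' : Alloc sg}, Sound x S h h' →
      l.foldl (fun r k => r.bind (f k)) (some h'.alloc) = some A' →
      Sound x (l.foldl (fun S k => S.seq (T k)) S) h (l.foldl (fun h k => run k h) h') ∧
        (l.foldl (fun h k => run k h) h').alloc = A'
  | [], h, h', S, A', s, hA => ⟨s, Option.some.inj hA⟩
  | k :: l, h, h', S, A', s, hA => by
      rw [List.foldl_cons, Option.bind_some] at hA
      cases hk : f k h'.alloc with
      | none => rw [hk, Prog.foldl_profile_none] at hA; cases hA
      | some B =>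
        obtain ⟨s', ha⟩ := hf k B h' hk s.isLocal
        rw [hk, ← ha] at hA
        exact foldl f run T hf l (s.trans s') hA

/-- Symbolic execution is sound for the translation. -/
theorem Prog.sound : ∀ (p : Prog sg) (ρ : Env) (A' : Alloc sg) (h : HPS sg),
    p.profile ρ h.alloc = some A' → h.Local x →
      Sound x (p.toStmt ρ) h (p.run ρ h) ∧ (p.run ρ h).alloc = A'
  | .init Q, ρ, A', h, hA, l => by
      rw [profile] at hA
      split_ifs at hA with hd
      rw [← Option.some.inj hA, toStmt, run]
      exact Sound.initRegister _ (Q.nodup_cells ρ) (Sound.refl l) hd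
  | .quantum p, ρ, A', h, hA, l => by
      rw [profile] at hA
      split_ifs at hA with hw
      rw [← Option.some.inj hA, run]
      exact Sound.quantum l hw
  | .seq p q, ρ, A', h, hA, l => by
      rw [profile] at hA
      obtain ⟨B, hB, hA⟩ := Option.bind_eq_some_iff.1 hA
      obtain ⟨s, rfl⟩ := sound p ρ B h hB l
      obtain ⟨s', ha⟩ := sound q ρ A' _ hA s.isLocal
      rw [toStmt, run]
      exact ⟨s.trans s', ha⟩
  | .loop y i j p, ρ, A', h, hA, l => by
      rw [profile] at hA
      rw [toStmt, run]
      exact Sound.foldl (fun k A => p.profile (Function.update ρ y k) A)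
        (fun k h => p.run (Function.update ρ y k) h) _
        (fun k A'' h' hA'' l' => sound p _ A'' h' hA'' l') _ (Sound.refl l) hA
  | .ite b p q, ρ, A', h, hA, l => by
      rw [profile] at hA
      split_ifs at hA with hc
      have e₁ : ∀ t, (b.sym ρ h).eval (val x t) =
          b.value ρ (h.history (val x t)).present.bits := fun t => b.eval_sym ρ h _
      have e₂ : ∀ t, (BExp.xor BExp.one (b.sym ρ h)).eval (val x t) =
          !b.value ρ (h.history (val x t)).present.bits := fun t => by
        rw [BExp.eval, b.eval_sym]; simp [BExp.eval]
      obtain ⟨s₁, a₁⟩ := sound p ρ A' (h.restrict (b.sym ρ h)) hA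
        (l.restrict (fun η _ => b.value ρ η.present.bits) e₁)
      obtain ⟨s₂, a₂⟩ := sound q ρ A' (h.restrict (BExp.xor BExp.one (b.sym ρ h)))
        (hc.2 ▸ hA) (l.restrict (fun η _ => !b.value ρ η.present.bits) e₂)
      rw [toStmt, run]
      exact ⟨s₁.ite s₂ (a₁.trans a₂.symm), (plus_alloc _ _ (a₁.trans a₂.symm)).trans a₁⟩
  | .measure Q C, ρ, A', h, hA, l => by
      rw [profile] at hA
      split_ifs at hA with hw
      rw [← Option.some.inj hA, run]
      exact ⟨Sound.measure l hw.1 hw.2,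
        (measure_pushStep (x := x) h (Q.cells ρ) (C.cells ρ) hw.2).alloc⟩
  | .oracle C₁ f C₂, ρ, A', h, hA, l => by
      rw [profile] at hA
      split_ifs at hA with hw
      rw [← Option.some.inj hA]
      refine ⟨Sound.oracle l ρ C₁ C₂ f, ?_⟩
      rw [run]
      exact (oracle_pushStep (x := x) h (C₁.cells ρ) (C₂.cells ρ) f).alloc

end Soundness
end HQ

theorem theorem7p1 (sg : HQ.Sig) :
    ∃ φ : HQ.ClosedProg sg → HQ.Stmt sg,
      ¬ Function.Surjective φ ∧
      ∀ (Pr : HQ.ClosedProg sg) (h : HQ.HPS sg) (x : ℕ → Bool),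
        h.WellScoped → HQ.ClosedProg.WellFormed Pr h.alloc → h.norm x ≤ 1 →
          HQ.IsCQState h.alloc.q (h.densityOp x) ∧
          HQ.IsCQState (HQ.ClosedProg.run Pr h).alloc.q
            ((HQ.ClosedProg.run Pr h).densityOp x) ∧
          (HQ.ClosedProg.run Pr h).densityOp x = (φ Pr).sem (h.densityOp x) := by
  refine ⟨fun Pr => Pr.1.toStmt HQ.Env.empty, fun hs => ?_, fun Pr h x hw hp hn => ?_⟩
  · obtain ⟨Pr, hPr⟩ := hs .abort
    exact HQ.Prog.toStmt_ne_abort _ _ hPr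
  · obtain ⟨A', hA'⟩ := Option.isSome_iff_exists.1 hp
    obtain ⟨s, -⟩ := Pr.1.sound HQ.Env.empty A' h hA' (hw.local x)
    have hm : (h.mass x).re ≤ 1 := by
      rw [HQ.HPS.mass_eq_norm_sq, Complex.ofReal_re]
      exact pow_le_one₀ (Real.sqrt_nonneg _) hn
    exact ⟨h.isCQState x hm, HQ.HPS.isCQState _ x (s.mass ▸ hm), s.densityOp⟩
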